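/- Let $\mathbb{H}=\{z\in\mathbb{C}:\operatorname{Im} z>0\}$ and $d(z,w)=\left|\frac{w-z}{w-\overline z}\right|$ for $z,w\in\mathbb{H}$. Say that $z\to\infty$ non-tangentially if $z\to\infty$ within a sector $\{z\in\mathbb{H}:|\operatorname{Arg} z-\pi/2|<\theta\}$; a non-tangential limit at $\infty$ is a limit that holds in this sense for every $\theta\in(0,\pi/2)$. Let $\phi$ be an analytic self-map of $\mathbb{H}$ of parabolic type, i.e. $\phi(z)\to\infty$ and $\phi(z)/z\to1$ as $z\to\infty$ non-tangentially. Let $w_n=x_n+iy_n\in\mathbb{H}$ $(n\ge0)$ be a backward-iteration sequence for $\phi$, i.e. $\phi(w_{n+1})=w_n$ for all $n\ge 0$, with $d(w_n,w_{n+1})\to a<1$ as $n\to\infty$. Assume that $w_n\to\infty$ and $\operatorname{Arg} w_n\to0$. Put $$b_0=\frac{2a}{\sqrt{1-a^2}},\qquad \zeta_n=i+nb_0,\qquad \tau_n(z)=x_n+y_nz,$$ and let $\phi_n$ denote the $n$-th iterate of $\phi$. Then $b_0=\lim_{n\to\infty}(x_{n+1}-x_n)/y_n$, and $\phi_n\circ\tau_n$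 converges, uniformly on compact subsets of $\mathbb{H}$, to an analytic self-map $\psi$ of $\mathbb{H}$ with $\psi(z-b_0)=\phi(\psi(z))$ for all $z\in\mathbb{H}$. Moreover: 1. $\psi(\zeta_n)=w_n$ for every $n\ge0$, and $\psi'(\zeta_n)/y_n\to1$ as $n\to\infty$. 2. $\psi$ has non-tangential limit $\infty$ at $\infty$. 3. $\phi'(w_n)\to1$ as $n\to\infty$. -/

import Mathlib

open Filter Topology Set

/-- The pseudo-hyperbolic distance of the upper half-plane, `|(w - z) / (w - conj z)|`. -/
noncomputable def pseudoHypDist (z w : ℂ) : ℝ :=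
  ‖(w - z) / (w - (starRingEnd ℂ) z)‖

/-- The sector `{z ∈ ℍ : |Arg z - π/2| < θ}`, a non-tangential approach region at infinity
(used with `0 < θ < π / 2`). -/
def sectorAtInfty (θ : ℝ) : Set ℂ :=
  {z : ℂ | z ∈ UpperHalfPlane.upperHalfPlaneSet ∧ |z.arg - Real.pi / 2| < θ}

/-- `f z` tends to the limit described by the filter `l` as `z` tends to infinity
non-tangentially in the upper half-plane. -/
def NTTendstoAtInfty (f : ℂ → ℂ) (l : Filter ℂ) : Prop :=
  ∀ θ : ℝ, 0 < θ → θ < Real.pi / 2 →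
    Tendsto f (Bornology.cobounded ℂ ⊓ 𝓟 (sectorAtInfty θ)) l

/-- `φ` is an analytic self-map of the upper half-plane. -/
structure IsAnalyticSelfMap (φ : ℂ → ℂ) : Prop where
  differentiableOn : DifferentiableOn ℂ φ UpperHalfPlane.upperHalfPlaneSet
  mapsTo : MapsTo φ UpperHalfPlane.upperHalfPlaneSet UpperHalfPlane.upperHalfPlaneSet

/-- An analytic self-map of the upper half-plane of parabolic type, normalized to have its
Denjoy-Wolff point at infinity: `φ z → ∞` and `φ z / z → 1` as `z → ∞` non-tangentially. -/
structure IsParabolicSelfMap (φ : ℂ → ℂ) : Prop extends IsAnalyticSelfMap φ where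
  tendsto_infty : NTTendstoAtInfty φ (Bornology.cobounded ℂ)
  tendsto_div : NTTendstoAtInfty (fun z => φ z / z) (𝓝 1)

/-- `w` is a backward-iteration sequence for `φ` in the upper half-plane. -/
structure IsBackwardIteration (φ : ℂ → ℂ) (w : ℕ → ℂ) : Prop where
  mem : ∀ n, w n ∈ UpperHalfPlane.upperHalfPlaneSet
  map_succ : ∀ n, φ (w (n + 1)) = w n

/-- The automorphism `z ↦ x + y z` of the upper half-plane attached to the point `p = x + i y`;
it sends `i` to `p`. -/
noncomputable def normAut (p z : ℂ) : ℂ := (p.re : ℂ) + (p.im : ℂ) * z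

/-- The translation length `2a / √(1 - a²)` attached to the limiting step `a`. -/
noncomputable def stepTranslation (a : ℝ) : ℝ := 2 * a / Real.sqrt (1 - a ^ 2)

/-- `F n → f` uniformly on every compact subset of the upper half-plane. -/
def TendstoUniformlyOnCompactsHP (F : ℕ → ℂ → ℂ) (f : ℂ → ℂ) : Prop :=
  ∀ K : Set ℂ, K ⊆ UpperHalfPlane.upperHalfPlaneSet → IsCompact K → TendstoUniformlyOn F f atTop K

/-! By Julia's lemma a parabolic self-map does not lower imaginary parts. Hence `f - id`, and `f^[k]
- id` for each iterate, map into the closed half-plane, and Schwarz–Pick applies to them as well as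
to `f`. Write y_n for the height of `w n`, v_n for `stepVec`, c_n = y_{n+1}/y_n for `heightRatio`
and T_n for `stepSinhSq`. Then |v_n|² = 4 c_n T_n, Im v_n = c_n - 1, and T_n increases to a²/(1 -
a²).

The main point is c_n → 1. Schwarz–Pick for `f - id` gives v_{n+1} - v_n → 0. If c_n ≤ c < 1 for
some large n, the next steps imitate a hyperbolic automorphism contracting to the real point w_n +
y_n v_n/(1 - c_n). Comparing the displacements of `f` at that time and at a later one shows that the
ratio cannot climb back above a given c₁ > c (`eventually_heightRatio_le`). The heights and steps
then decay geometrically and the orbit converges, which contradicts w_n → ∞. So c_n → 1 and |v_n| →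
b₀. As v_n varies slowly its sign is eventually constant, and Re w_n → +∞ makes it positive: v_n →
b₀. The derivative claim follows from |f'(w_{n+1}) - 1| ≤ 1/c_n - 1.

For the conjugation, the maps τ_n⁻¹ ∘ f^[m-n] ∘ τ_m fix i and send i + v_m to i + v_n, both near i +
b₀. A self-map that fixes i and almost fixes a second point is close to the identity on compact sets
(`exists_forall_norm_map_sub_lt`), so the normalized iterates are uniformly Cauchy. The same
rigidity applied to τ_n⁻¹ ∘ ψ(· + n b₀) gives the asymptotics of ψ' and shows that ψ → ∞ along the
line Im z = 1. A Lindelöf theorem, proved by Phragmén–Lindelöf, passes from this ray to sectors. -/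

/-! ### Schwarz–Pick in the half-plane. -/

theorem isOpen_im_pos : IsOpen {z : ℂ | 0 < z.im} :=
  isOpen_lt continuous_const Complex.continuous_im

theorem norm_sub_conj_sq (z w : ℂ) :
    ‖z - (starRingEnd ℂ) w‖ ^ 2 = ‖z - w‖ ^ 2 + 4 * (z.im * w.im) := by
  simp only [Complex.sq_norm, Complex.normSq_apply, Complex.sub_re, Complex.sub_im,
    Complex.conj_re, Complex.conj_im]
  ring

theorem sub_conj_ne_zero {z w : ℂ} (hz : 0 < z.im) (hw : 0 < w.im) :
    z - (starRingEnd ℂ) w ≠ 0 := by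
  intro h
  have := congrArg Complex.im h
  simp at this
  linarith

theorem norm_sub_lt_norm_sub_conj {z w : ℂ} (hz : 0 < z.im) (hw : 0 < w.im) :
    ‖z - w‖ < ‖z - (starRingEnd ℂ) w‖ := by
  have h := norm_sub_conj_sq z w
  have := mul_pos hz hw
  exact lt_of_pow_lt_pow_left₀ 2 (norm_nonneg _) (by linarith)

/-- The Möbius map from the unit disk to the upper half-plane that sends `0` to `w`. -/
noncomputable def diskToHP (w ζ : ℂ) : ℂ := (w - (starRingEnd ℂ) w * ζ) / (1 - ζ)

theorem diskToHP_im (w ζ : ℂ) :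
    (diskToHP w ζ).im = w.im * (1 - ‖ζ‖ ^ 2) / ‖1 - ζ‖ ^ 2 := by
  rw [diskToHP, Complex.div_im, Complex.sq_norm, Complex.sq_norm, Complex.normSq_apply ζ,
    ← sub_div]
  congr 1
  simp
  ring

theorem diskToHP_im_pos {w ζ : ℂ} (hw : 0 < w.im) (hζ : ‖ζ‖ < 1) : 0 < (diskToHP w ζ).im := by
  rw [diskToHP_im]
  have h1 : 0 < ‖1 - ζ‖ := by
    rw [norm_pos_iff, sub_ne_zero]
    rintro rfl
    simp at hζ
  have : 0 < 1 - ‖ζ‖ ^ 2 := by nlinarith [norm_nonneg ζ]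
  positivity

theorem diskToHP_apply_div {z w : ℂ} (hz : 0 < z.im) (hw : 0 < w.im) :
    diskToHP w ((z - w) / (z - (starRingEnd ℂ) w)) = z := by
  have h1 := sub_conj_ne_zero hz hw
  have h2 := sub_conj_ne_zero hw hw
  have h3 : 1 - (z - w) / (z - (starRingEnd ℂ) w) ≠ 0 := by
    rw [one_sub_div h1]
    refine div_ne_zero ?_ h1
    convert h2 using 1
    ring
  rw [diskToHP, div_eq_iff h3]
  field_simp
  ring

/-- Schwarz-Pick inequality for self-maps of the upper half-plane, in Euclidean form. -/
theorem schwarzPick_of_pos {f : ℂ → ℂ} (hd : DifferentiableOn ℂ f {z | 0 < z.im})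
    (hf : ∀ z : ℂ, 0 < z.im → 0 < (f z).im) {z w : ℂ} (hz : 0 < z.im) (hw : 0 < w.im) :
    ‖f z - f w‖ ^ 2 * (z.im * w.im) ≤ (f z).im * (f w).im * ‖z - w‖ ^ 2 := by
  set g : ℂ → ℂ := fun ζ =>
    (f (diskToHP w ζ) - f w) / (f (diskToHP w ζ) - (starRingEnd ℂ) (f w)) with hg
  have hM : ∀ ζ ∈ Metric.ball (0 : ℂ) 1, 0 < (diskToHP w ζ).im := fun ζ hζ =>
    diskToHP_im_pos hw (by simpa using hζ)
  have hMd : DifferentiableOn ℂ (diskToHP w) (Metric.ball 0 1) := by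
    unfold diskToHP
    refine DifferentiableOn.div (by fun_prop) (by fun_prop) fun ζ hζ h => ?_
    rw [sub_eq_zero] at h
    simp [← h] at hζ
  have hfM : DifferentiableOn ℂ (fun ζ => f (diskToHP w ζ)) (Metric.ball 0 1) :=
    hd.comp hMd hM
  have hgd : DifferentiableOn ℂ g (Metric.ball 0 1) :=
    (hfM.sub_const _).div (hfM.sub_const _) fun ζ hζ =>
      sub_conj_ne_zero (hf _ (hM ζ hζ)) (hf w hw)
  have hgm : MapsTo g (Metric.ball 0 1) (Metric.ball 0 1) := by
    intro ζ hζ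
    have h := norm_sub_lt_norm_sub_conj (hf _ (hM ζ hζ)) (hf w hw)
    rw [mem_ball_zero_iff, hg, norm_div, div_lt_one ((norm_nonneg _).trans_lt h)]
    exact h
  have hg0 : g 0 = 0 := by simp [hg, diskToHP]
  have hlt := norm_sub_lt_norm_sub_conj hz hw
  have hpos := (norm_nonneg _).trans_lt hlt
  have hζ : ‖(z - w) / (z - (starRingEnd ℂ) w)‖ < 1 := by
    rwa [norm_div, div_lt_one hpos]
  have key := Complex.norm_le_norm_of_mapsTo_ball hgd (hgm.mono_right Metric.ball_subset_closedBall) hg0 hζ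
  simp only [hg, diskToHP_apply_div hz hw] at key
  have hlt' := norm_sub_lt_norm_sub_conj (hf z hz) (hf w hw)
  have hpos' := (norm_nonneg _).trans_lt hlt'
  rw [norm_div, norm_div, div_le_div_iff₀ hpos' hpos] at key
  have key2 := pow_le_pow_left₀ (by positivity) key 2
  rw [mul_pow, mul_pow, norm_sub_conj_sq, norm_sub_conj_sq] at key2
  nlinarith

/-- Schwarz-Pick inequality for maps of the upper half-plane to the closed upper half-plane. -/
theorem schwarzPick {f : ℂ → ℂ} (hd : DifferentiableOn ℂ f {z | 0 < z.im})
    (hf : ∀ z : ℂ, 0 < z.im → 0 ≤ (f z).im) {z w : ℂ} (hz : 0 < z.im) (hw : 0 < w.im) :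
    ‖f z - f w‖ ^ 2 * (z.im * w.im) ≤ (f z).im * (f w).im * ‖z - w‖ ^ 2 := by
  have h1 : ∀ᶠ ε : ℝ in 𝓝[>] 0, ‖f z - f w‖ ^ 2 * (z.im * w.im) ≤
      ((f z).im + ε) * ((f w).im + ε) * ‖z - w‖ ^ 2 := by
    filter_upwards [self_mem_nhdsWithin] with ε hε
    have := schwarzPick_of_pos (f := fun z => f z + ε * Complex.I) (hd.add_const _)
      (fun z hz => by
        have := hf z hz
        have hε' : 0 < ε := hε
        simp; linarith) hz hw
    simpa using this
  have h2 : Tendsto (fun ε : ℝ => ((f z).im + ε) * ((f w).im + ε) * ‖z - w‖ ^ 2) (𝓝[>] 0)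
      (𝓝 (((f z).im + 0) * ((f w).im + 0) * ‖z - w‖ ^ 2)) := by
    apply Tendsto.mono_left _ nhdsWithin_le_nhds
    apply Continuous.tendsto (f := fun ε : ℝ => ((f z).im + ε) * ((f w).im + ε) * ‖z - w‖ ^ 2)
    fun_prop
  simpa using ge_of_tendsto h2 h1

/-- Infinitesimal form of `schwarzPick`: let one point tend to the other. -/
theorem norm_deriv_le_im_div {f : ℂ → ℂ} (hd : DifferentiableOn ℂ f {z | 0 < z.im})
    (hf : ∀ z : ℂ, 0 < z.im → 0 ≤ (f z).im) {w : ℂ} (hw : 0 < w.im) :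
    ‖deriv f w‖ ≤ (f w).im / w.im := by
  have hdw : DifferentiableAt ℂ f w := hd.differentiableAt (isOpen_im_pos.mem_nhds hw)
  have h1 : Tendsto (fun z => ‖slope f w z‖ ^ 2) (𝓝[≠] w) (𝓝 (‖deriv f w‖ ^ 2)) :=
    ((hasDerivAt_iff_tendsto_slope.mp hdw.hasDerivAt).norm).pow 2
  have h2 : Tendsto (fun z => (f z).im * (f w).im / (z.im * w.im)) (𝓝[≠] w)
      (𝓝 ((f w).im * (f w).im / (w.im * w.im))) := by
    apply Tendsto.mono_left _ nhdsWithin_le_nhds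
    have hc : Tendsto f (𝓝 w) (𝓝 (f w)) := hdw.continuousAt
    have hi : Tendsto (fun z => (f z).im) (𝓝 w) (𝓝 (f w).im) :=
      (Complex.continuous_im.tendsto _).comp hc
    exact (hi.mul_const _).div ((Complex.continuous_im.tendsto w).mul_const _) (by positivity)
  have h3 : ‖deriv f w‖ ^ 2 ≤ (f w).im * (f w).im / (w.im * w.im) := by
    refine le_of_tendsto_of_tendsto h1 h2 ?_
    have hev : ∀ᶠ z in 𝓝[≠] w, 0 < z.im :=
      nhdsWithin_le_nhds (isOpen_im_pos.mem_nhds hw)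
    filter_upwards [hev, self_mem_nhdsWithin] with z hz hzw
    have hne : 0 < ‖z - w‖ := by
      rw [norm_pos_iff, sub_ne_zero]; exact hzw
    have := schwarzPick hd hf hz hw
    rw [slope_def_field, norm_div, div_pow, div_le_div_iff₀ (by positivity) (by positivity)]
    linarith
  have h4 : (f w).im * (f w).im / (w.im * w.im) = ((f w).im / w.im) ^ 2 := by
    rw [div_pow]; ring
  rw [h4] at h3
  exact le_of_sq_le_sq h3 (div_nonneg (hf w hw) hw.le)

/-! ### Julia's lemma and maps that do not lower heights. -/

theorem tendsto_ofReal_mul_I_sectorAtInfty {θ : ℝ} (hθ : 0 < θ) :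
    Tendsto (fun t : ℝ => (t : ℂ) * Complex.I) atTop
      (Bornology.cobounded ℂ ⊓ 𝓟 (sectorAtInfty θ)) := by
  refine tendsto_inf.mpr ⟨?_, tendsto_principal.mpr ?_⟩
  · rw [← tendsto_norm_atTop_iff_cobounded]
    simpa using tendsto_abs_atTop_atTop
  · filter_upwards [eventually_gt_atTop 0] with t ht
    refine ⟨by simpa [UpperHalfPlane.upperHalfPlaneSet] using ht, ?_⟩
    rw [Complex.arg_real_mul _ ht, Complex.arg_I]
    simpa using hθ

/-- Julia's lemma at infinity: a self-map of parabolic type does not decrease imaginary parts. -/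
theorem IsParabolicSelfMap.im_le_im {φ : ℂ → ℂ} (hφ : IsParabolicSelfMap φ) {z : ℂ}
    (hz : 0 < z.im) : z.im ≤ (φ z).im := by
  have hd : DifferentiableOn ℂ φ {z | 0 < z.im} := hφ.differentiableOn
  have hm : ∀ z : ℂ, 0 < z.im → 0 < (φ z).im := fun z hz => hφ.mapsTo hz
  have h1 : Tendsto (fun t : ℝ => φ ((t : ℂ) * Complex.I) / ((t : ℂ) * Complex.I)) atTop (𝓝 1) :=
    (hφ.tendsto_div (Real.pi / 4) (by positivity) (by linarith [Real.pi_pos])).comp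
      (tendsto_ofReal_mul_I_sectorAtInfty (by positivity))
  have h2 : Tendsto (fun t : ℝ => φ ((t : ℂ) * Complex.I) / (t : ℂ)) atTop (𝓝 Complex.I) := by
    have := h1.mul_const Complex.I
    rw [one_mul] at this
    refine this.congr' ?_
    filter_upwards [eventually_gt_atTop 0] with t ht
    have : (t : ℂ) ≠ 0 := by exact_mod_cast ht.ne'
    field_simp
  have h0 : ∀ c : ℂ, Tendsto (fun t : ℝ => c / (t : ℂ)) atTop (𝓝 0) := fun c => by
    rw [tendsto_zero_iff_norm_tendsto_zero]
    have : Tendsto (fun t : ℝ => ‖c‖ / |t|) atTop (𝓝 0) :=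
      tendsto_const_nhds.div_atTop tendsto_abs_atTop_atTop
    simpa using this
  -- The two sides of Schwarz–Pick at `z` and `t * I`, divided by `t ^ 3`; in the limit the
  -- inequality reads `z.im ≤ (φ z).im`.
  have hL : Tendsto (fun t : ℝ => ‖φ z / t - φ ((t : ℂ) * Complex.I) / t‖ ^ 2 * z.im) atTop
      (𝓝 (‖(0 : ℂ) - Complex.I‖ ^ 2 * z.im)) :=
    ((((h0 (φ z)).sub h2).norm).pow 2).mul_const _
  have hR : Tendsto (fun t : ℝ => (φ z).im * (φ ((t : ℂ) * Complex.I) / t).im *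
      ‖z / t - Complex.I‖ ^ 2) atTop
      (𝓝 ((φ z).im * Complex.I.im * ‖(0 : ℂ) - Complex.I‖ ^ 2)) :=
    ((((Complex.continuous_im.tendsto _).comp h2).const_mul _)).mul
      (((h0 z).sub_const _).norm.pow 2)
  have := le_of_tendsto_of_tendsto hL hR ?_
  · simpa using this
  filter_upwards [eventually_gt_atTop 0] with t ht
  have ht' : (t : ℂ) ≠ 0 := by exact_mod_cast ht.ne'
  have key := schwarzPick_of_pos hd hm hz (w := (t : ℂ) * Complex.I) (by simpa using ht)
  have e1 : φ z / t - φ ((t : ℂ) * Complex.I) / t = (φ z - φ ((t : ℂ) * Complex.I)) / t := by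
    rw [sub_div]
  have e2 : z / t - Complex.I = (z - t * Complex.I) / t := by field_simp
  have e3 : (φ ((t : ℂ) * Complex.I) / t).im = (φ ((t : ℂ) * Complex.I)).im / t :=
    Complex.div_ofReal_im _ _
  have e4 : ((t : ℂ) * Complex.I).im = t := by simp
  rw [e4] at key
  rw [e1, e2, e3, norm_div, norm_div, div_pow, div_pow, Complex.norm_real, Real.norm_eq_abs,
    sq_abs]
  have : (φ z).im * ((φ ((t : ℂ) * Complex.I)).im / t) * (‖z - t * Complex.I‖ ^ 2 / t ^ 2) -
      ‖φ z - φ ((t : ℂ) * Complex.I)‖ ^ 2 / t ^ 2 * z.im =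
      ((φ z).im * (φ ((t : ℂ) * Complex.I)).im * ‖z - t * Complex.I‖ ^ 2 -
      ‖φ z - φ ((t : ℂ) * Complex.I)‖ ^ 2 * (z.im * t)) / t ^ 3 := by
    field_simp
  have h3 : 0 ≤ ((φ z).im * (φ ((t : ℂ) * Complex.I)).im * ‖z - t * Complex.I‖ ^ 2 -
      ‖φ z - φ ((t : ℂ) * Complex.I)‖ ^ 2 * (z.im * t)) / t ^ 3 :=
    div_nonneg (by linarith) (by positivity)
  linarith

/-- Properties shared by the iterates of a self-map of parabolic type. -/
structure IncreasesIm (f : ℂ → ℂ) : Prop where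
  diff : DifferentiableOn ℂ f {z | 0 < z.im}
  le : ∀ z : ℂ, 0 < z.im → z.im ≤ (f z).im

theorem IncreasesIm.pos {f : ℂ → ℂ} (hf : IncreasesIm f) (z : ℂ) (hz : 0 < z.im) :
    0 < (f z).im := hz.trans_le (hf.le z hz)

theorem IsParabolicSelfMap.increasesIm {φ : ℂ → ℂ} (hφ : IsParabolicSelfMap φ) :
    IncreasesIm φ :=
  ⟨hφ.differentiableOn, fun _ hz => hφ.im_le_im hz⟩

theorem IncreasesIm.iterate {f : ℂ → ℂ} (hf : IncreasesIm f) (n : ℕ) : IncreasesIm f^[n] := by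
  induction n with
  | zero => exact ⟨differentiableOn_id, fun z _ => le_rfl⟩
  | succ n ih =>
    rw [Function.iterate_succ']
    exact ⟨hf.diff.comp ih.diff ih.pos,
      fun z hz => (ih.le z hz).trans (hf.le _ (ih.pos z hz))⟩

/-- `f - id` takes values in the closed half-plane. This is stronger information than Schwarz–Pick
for `f` and drives all estimates on the orbit. -/
theorem IncreasesIm.schwarzPick_sub {f : ℂ → ℂ} (hf : IncreasesIm f) {z w : ℂ} (hz : 0 < z.im)
    (hw : 0 < w.im) : ‖(f z - z) - (f w - w)‖ ^ 2 * (z.im * w.im) ≤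
      ((f z).im - z.im) * ((f w).im - w.im) * ‖z - w‖ ^ 2 := by
  have := schwarzPick (f := fun z => f z - z) (hf.diff.sub differentiableOn_id)
    (fun z hz => by simpa using hf.le z hz) hz hw
  simpa using this

theorem IncreasesIm.norm_deriv_sub_one_le {f : ℂ → ℂ} (hf : IncreasesIm f) {w : ℂ}
    (hw : 0 < w.im) : ‖deriv f w - 1‖ ≤ ((f w).im - w.im) / w.im := by
  have h := norm_deriv_le_im_div (f := fun z => f z - z) (hf.diff.sub differentiableOn_id)
    (fun z hz => by simpa using hf.le z hz) hw
  have hdw : DifferentiableAt ℂ f w := hf.diff.differentiableAt (isOpen_im_pos.mem_nhds hw)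
  rw [deriv_fun_sub hdw differentiableAt_fun_id, deriv_id''] at h
  simpa using h

/-! ### Steps and heights of a backward orbit. -/

/-- A backward orbit of a map of the upper half-plane that does not decrease imaginary parts. -/
structure IsBackwardOrbit (f : ℂ → ℂ) (w : ℕ → ℂ) : Prop where
  inc : IncreasesIm f
  pos : ∀ n, 0 < (w n).im
  map : ∀ n, f (w (n + 1)) = w n

/-- The step `w n → w (n + 1)`, rescaled by the height of `w n`. -/
noncomputable def stepVec (w : ℕ → ℂ) (n : ℕ) : ℂ := (w (n + 1) - w n) / ((w n).im : ℂ)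

/-- The quotient of consecutive heights. -/
noncomputable def heightRatio (w : ℕ → ℂ) (n : ℕ) : ℝ := (w (n + 1)).im / (w n).im

/-- The square of the hyperbolic sine of half the hyperbolic length of a step. -/
noncomputable def stepSinhSq (w : ℕ → ℂ) (n : ℕ) : ℝ :=
  ‖w (n + 1) - w n‖ ^ 2 / (4 * ((w n).im * (w (n + 1)).im))

/-- The pseudo-hyperbolic distance is tanh of half the hyperbolic one, and tanh²/(1 - tanh²) =
sinh². -/
theorem pseudoHypDist_sq_div {z w : ℂ} (hz : 0 < z.im) (hw : 0 < w.im) :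
    pseudoHypDist z w ^ 2 / (1 - pseudoHypDist z w ^ 2) = ‖w - z‖ ^ 2 / (4 * (z.im * w.im)) := by
  rw [pseudoHypDist, norm_div, div_pow, norm_sub_conj_sq]
  have h := mul_pos hz hw
  have h1 : 0 < ‖w - z‖ ^ 2 + 4 * (w.im * z.im) := by nlinarith [sq_nonneg ‖w - z‖]
  have h2 : 1 - ‖w - z‖ ^ 2 / (‖w - z‖ ^ 2 + 4 * (w.im * z.im)) =
      4 * (w.im * z.im) / (‖w - z‖ ^ 2 + 4 * (w.im * z.im)) := by
    rw [one_sub_div h1.ne']; ring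
  rw [h2, div_div_div_cancel_right₀ h1.ne', mul_comm w.im]

namespace IsBackwardOrbit

variable {f : ℂ → ℂ} {w : ℕ → ℂ}

theorem iterate_map (h : IsBackwardOrbit f w) (k n : ℕ) : f^[k] (w (n + k)) = w n := by
  induction k with
  | zero => rfl
  | succ k ih =>
    rw [Function.iterate_succ_apply, ← add_assoc, h.map, ih]

theorem iterate_map_sub (h : IsBackwardOrbit f w) {n m : ℕ} (hnm : n ≤ m) :
    f^[m - n] (w m) = w n := by
  have := h.iterate_map (m - n) n
  rwa [Nat.add_sub_cancel' hnm] at this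

theorem im_ne_zero (h : IsBackwardOrbit f w) (n : ℕ) : ((w n).im : ℂ) ≠ 0 := by
  exact_mod_cast (h.pos n).ne'

theorem im_antitone (h : IsBackwardOrbit f w) : Antitone fun n => (w n).im :=
  antitone_nat_of_succ_le fun n => by
    have := h.inc.le _ (h.pos (n + 1))
    rwa [h.map] at this

theorem succ_eq (h : IsBackwardOrbit f w) (n : ℕ) :
    w (n + 1) = w n + (w n).im * stepVec w n := by
  rw [stepVec, mul_div_cancel₀ _ (h.im_ne_zero n)]
  ring

theorem heightRatio_eq (h : IsBackwardOrbit f w) (n : ℕ) :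
    heightRatio w n = 1 + (stepVec w n).im := by
  rw [heightRatio, stepVec, Complex.div_ofReal_im, Complex.sub_im, sub_div,
    div_self (h.pos n).ne']
  ring

theorem heightRatio_pos (h : IsBackwardOrbit f w) (n : ℕ) : 0 < heightRatio w n :=
  div_pos (h.pos _) (h.pos _)

theorem heightRatio_le_one (h : IsBackwardOrbit f w) (n : ℕ) : heightRatio w n ≤ 1 :=
  div_le_one_of_le₀ (h.im_antitone n.le_succ) (h.pos n).le

theorem im_succ (h : IsBackwardOrbit f w) (n : ℕ) :
    (w (n + 1)).im = (w n).im * heightRatio w n := by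
  rw [heightRatio, mul_div_cancel₀ _ (h.pos n).ne']

theorem norm_stepVec_sq (h : IsBackwardOrbit f w) (n : ℕ) :
    ‖stepVec w n‖ ^ 2 = 4 * heightRatio w n * stepSinhSq w n := by
  have h0 := (h.pos n).ne'
  have h1 := (h.pos (n + 1)).ne'
  rw [stepVec, heightRatio, stepSinhSq, norm_div, Complex.norm_real, Real.norm_eq_abs, div_pow,
    sq_abs]
  field_simp

theorem stepSinhSq_nonneg (h : IsBackwardOrbit f w) (n : ℕ) : 0 ≤ stepSinhSq w n :=
  div_nonneg (sq_nonneg _)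
    (mul_nonneg (by norm_num) (mul_nonneg (h.pos n).le (h.pos (n + 1)).le))

/-- `f` contracts hyperbolic distance and carries each step to the preceding one. -/
theorem stepSinhSq_monotone (h : IsBackwardOrbit f w) : Monotone (stepSinhSq w) :=
  monotone_nat_of_le_succ fun n => by
    have h0 := h.pos n
    have h1 := h.pos (n + 1)
    have h2 := h.pos (n + 2)
    have key := schwarzPick_of_pos h.inc.diff h.inc.pos h2 h1
    rw [h.map, h.map] at key
    rw [stepSinhSq, stepSinhSq, div_le_div_iff₀ (by positivity) (by positivity)]
    nlinarith

/-- Schwarz–Pick for `f^[m - n] - id` at `w m` and `w (m + 1)`, whose images under the iterate are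
`w n` and `w (n + 1)`. Substituting |v|² = 4cT at both indices leaves only the increment of T on the
right. -/
theorem sq_norm_stepVec_sub_le (h : IsBackwardOrbit f w) {n m : ℕ} (hnm : n ≤ m) :
    ‖stepVec w n - stepVec w m‖ ^ 2 ≤
      4 * heightRatio w n * (stepSinhSq w m - stepSinhSq w n) * ((w n).im / (w m).im - 1) := by
  have key := (h.inc.iterate (m - n)).schwarzPick_sub (h.pos m) (h.pos (m + 1))
  have e1 : f^[m - n] (w (m + 1)) = w (n + 1) := by
    have := h.iterate_map_sub (Nat.succ_le_succ hnm)
    rwa [Nat.succ_sub_succ] at this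
  rw [h.iterate_map_sub hnm, e1] at key
  have hn := h.norm_stepVec_sq n
  have hm := h.norm_stepVec_sq m
  have hc := h.heightRatio_pos n
  have hc' := h.heightRatio_pos m
  have hy := h.pos n
  have hy' := h.pos m
  have i1 := h.im_succ n
  have i2 := h.im_succ m
  have e2 : w n - w m - (w (n + 1) - w (m + 1)) =
      (w m).im * stepVec w m - (w n).im * stepVec w n := by
    rw [h.succ_eq n, h.succ_eq m]; ring
  have e3 : w m - w (m + 1) = - ((w m).im * stepVec w m) := by
    rw [h.succ_eq m]; ring
  rw [e2, e3, i1, i2] at key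
  generalize stepVec w n = v at *
  generalize stepVec w m = v' at *
  generalize heightRatio w n = c at *
  generalize heightRatio w m = c' at *
  generalize stepSinhSq w n = T at *
  generalize stepSinhSq w m = T' at *
  generalize (w n).im = y at *
  generalize (w m).im = y' at *
  simp only [norm_neg, Complex.sq_norm, Complex.normSq_apply, Complex.sub_re, Complex.sub_im,
    Complex.re_ofReal_mul, Complex.im_ofReal_mul] at *
  have hk : ((v.re - v'.re) * (v.re - v'.re) + (v.im - v'.im) * (v.im - v'.im)) * y' ≤
      4 * c * (T' - T) * (y - y') := by
    have k2 : (y * y' * y' ^ 2 * c') *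
        (4 * c * (T' - T) * (y - y') -
        ((v.re - v'.re) * (v.re - v'.re) + (v.im - v'.im) * (v.im - v'.im)) * y') * (1 / y') =
        (y - y') * (y * c - y' * c') * (y' ^ 2 * (4 * c' * T')) -
          (y' ^ 2 * (4 * c' * T') + y ^ 2 * (4 * c * T) -
            2 * y * y' * (v.re * v'.re + v.im * v'.im)) * (y' * (y' * c')) := by
      have : (v.re - v'.re) * (v.re - v'.re) + (v.im - v'.im) * (v.im - v'.im) =
          4 * c * T + 4 * c' * T' - 2 * (v.re * v'.re + v.im * v'.im) := by
        rw [← hn, ← hm]; ring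
      rw [this]
      field_simp
      ring
    have k3 : 0 ≤ (y * y' * y' ^ 2 * c') *
        (4 * c * (T' - T) * (y - y') -
        ((v.re - v'.re) * (v.re - v'.re) + (v.im - v'.im) * (v.im - v'.im)) * y') * (1 / y') := by
      rw [k2, ← hn, ← hm, sub_nonneg]
      convert key using 1 <;> ring
    have k4 : 0 ≤ (y * y' ^ 2 * c') *
        (4 * c * (T' - T) * (y - y') -
        ((v.re - v'.re) * (v.re - v'.re) + (v.im - v'.im) * (v.im - v'.im)) * y') := by
      convert k3 using 1
      field_simp
    have := nonneg_of_mul_nonneg_right k4 (by positivity)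
    linarith
  rw [← le_div_iff₀ hy'] at hk
  have e : 4 * c * (T' - T) * (y / y' - 1) = 4 * c * (T' - T) * (y - y') / y' := by
    field_simp
  rwa [e]

end IsBackwardOrbit

namespace IsBackwardOrbit

variable {f : ℂ → ℂ} {w : ℕ → ℂ} {S : ℝ}

theorem stepSinhSq_le (h : IsBackwardOrbit f w) (hT : Tendsto (stepSinhSq w) atTop (𝓝 S)) (n : ℕ) :
    stepSinhSq w n ≤ S :=
  h.stepSinhSq_monotone.ge_of_tendsto hT n

theorem limit_nonneg (h : IsBackwardOrbit f w) (hT : Tendsto (stepSinhSq w) atTop (𝓝 S)) :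
    0 ≤ S :=
  (h.stepSinhSq_nonneg 0).trans (h.stepSinhSq_le hT 0)

theorem norm_stepVec_le (h : IsBackwardOrbit f w) (hT : Tendsto (stepSinhSq w) atTop (𝓝 S))
    (n : ℕ) : ‖stepVec w n‖ ≤ Real.sqrt (4 * S) := by
  apply Real.le_sqrt_of_sq_le
  rw [h.norm_stepVec_sq]
  have h1 := h.stepSinhSq_le hT n
  have h2 := h.stepSinhSq_nonneg n
  have h3 := h.heightRatio_le_one n
  nlinarith

/-- Since Im v = c - 1, (1 - c)² ≤ |v|² ≤ 4cS, and so 1 ≤ (4S + 2)c. -/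
theorem inv_le_heightRatio (h : IsBackwardOrbit f w) (hT : Tendsto (stepSinhSq w) atTop (𝓝 S))
    (n : ℕ) : (4 * S + 2)⁻¹ ≤ heightRatio w n := by
  have hS := h.limit_nonneg hT
  have h1 : (stepVec w n).im ^ 2 ≤ ‖stepVec w n‖ ^ 2 := by
    rw [← sq_abs]
    exact pow_le_pow_left₀ (abs_nonneg _) (Complex.abs_im_le_norm _) 2
  have h2 : (stepVec w n).im = heightRatio w n - 1 := by rw [h.heightRatio_eq]; ring
  rw [h.norm_stepVec_sq, h2] at h1
  have h3 := h.stepSinhSq_le hT n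
  have h4 := h.heightRatio_pos n
  rw [inv_le_iff_one_le_mul₀ (by positivity)]
  nlinarith

theorem tendsto_stepVec_succ_sub (h : IsBackwardOrbit f w)
    (hT : Tendsto (stepSinhSq w) atTop (𝓝 S)) :
    Tendsto (fun n => stepVec w (n + 1) - stepVec w n) atTop (𝓝 0) := by
  have h1 : Tendsto (fun n => 4 * (stepSinhSq w (n + 1) - stepSinhSq w n)) atTop (𝓝 0) := by
    simpa using (((tendsto_add_atTop_iff_nat 1).mpr hT).sub hT).const_mul 4
  have h2 : Tendsto (fun n => ‖stepVec w (n + 1) - stepVec w n‖ ^ 2) atTop (𝓝 0) := by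
    refine squeeze_zero (fun n => by positivity) (fun n => ?_) h1
    have := h.sq_norm_stepVec_sub_le n.le_succ
    rw [norm_sub_rev, Nat.succ_eq_add_one] at this
    refine this.trans ?_
    have e : (w n).im / (w (n + 1)).im = (heightRatio w n)⁻¹ := by rw [heightRatio, inv_div]
    rw [e]
    have hc := h.heightRatio_pos n
    have hm := h.stepSinhSq_monotone n.le_succ
    rw [Nat.succ_eq_add_one] at hm
    have e2 : 4 * heightRatio w n * (stepSinhSq w (n + 1) - stepSinhSq w n) *
        ((heightRatio w n)⁻¹ - 1) =
        4 * (stepSinhSq w (n + 1) - stepSinhSq w n) * (1 - heightRatio w n) := by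
      field_simp
    rw [e2]
    exact mul_le_of_le_one_right (by linarith) (by linarith)
  rw [tendsto_zero_iff_norm_tendsto_zero]
  simpa [Real.sqrt_sq] using h2.sqrt

theorem tendsto_stepVec_add_sub (h : IsBackwardOrbit f w)
    (hT : Tendsto (stepSinhSq w) atTop (𝓝 S)) (j : ℕ) :
    Tendsto (fun n => stepVec w (n + j) - stepVec w n) atTop (𝓝 0) := by
  induction j with
  | zero => simp
  | succ j ih =>
    have h1 := ((tendsto_add_atTop_iff_nat j).mpr (h.tendsto_stepVec_succ_sub hT)).add ih
    rw [add_zero] at h1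
    refine h1.congr fun n => ?_
    rw [add_assoc]; ring

theorem tendsto_heightRatio_add_sub (h : IsBackwardOrbit f w)
    (hT : Tendsto (stepSinhSq w) atTop (𝓝 S)) (j : ℕ) :
    Tendsto (fun n => heightRatio w (n + j) - heightRatio w n) atTop (𝓝 0) := by
  have := (Complex.continuous_im.tendsto 0).comp (h.tendsto_stepVec_add_sub hT j)
  rw [Complex.zero_im] at this
  refine this.congr fun n => ?_
  simp [h.heightRatio_eq]

/-- Schwarz–Pick for `f - id` at `w (n + 1)` and `w (m + 1)`, where the displacements of `f` are the
steps with reversed sign. -/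
theorem sq_norm_sub_le_mul (h : IsBackwardOrbit f w) (n m : ℕ) :
    ‖(w n).im * stepVec w n - (w m).im * stepVec w m‖ ^ 2 ≤
      ((heightRatio w n)⁻¹ - 1) * ((heightRatio w m)⁻¹ - 1) * ‖w (m + 1) - w (n + 1)‖ ^ 2 := by
  have key := h.inc.schwarzPick_sub (h.pos (n + 1)) (h.pos (m + 1))
  rw [h.map, h.map] at key
  have e1 : w n - w (n + 1) - (w m - w (m + 1)) =
      -((w n).im * stepVec w n - (w m).im * stepVec w m) := by
    rw [h.succ_eq n, h.succ_eq m]; ring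
  have hn := h.pos (n + 1)
  have hm := h.pos (m + 1)
  rw [e1, norm_neg, norm_sub_rev (w (n + 1)), ← le_div_iff₀ (by positivity)] at key
  refine key.trans (le_of_eq ?_)
  rw [heightRatio, heightRatio, inv_div, inv_div]
  field_simp

theorem im_add_le (h : IsBackwardOrbit f w) {c : ℝ} (hc : 0 ≤ c) {n k : ℕ}
    (hk : ∀ i < k, heightRatio w (n + i) ≤ c) : (w (n + k)).im ≤ (w n).im * c ^ k := by
  induction k with
  | zero => simp
  | succ k ih =>
    rw [← add_assoc, h.im_succ, pow_succ, ← mul_assoc]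
    exact mul_le_mul (ih fun i hi => hk i (hi.trans k.lt_succ_self)) (hk k k.lt_succ_self)
      (h.heightRatio_pos _).le (mul_nonneg (h.pos n).le (pow_nonneg hc k))

/-- If v_i = (1 - c_i) q, the step leaves w_i + y_i q unchanged: this is the fixed point of the
model dilation. The sum collects the deviations from the model. -/
theorem add_sub_eq_sum (h : IsBackwardOrbit f w) (q : ℂ) (n k : ℕ) :
    w (n + k) + (w (n + k)).im * q - (w n + (w n).im * q) =
      ∑ i ∈ Finset.range k,
        ((w (n + i)).im : ℂ) * (stepVec w (n + i) - (1 - heightRatio w (n + i)) * q) := by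
  induction k with
  | zero => simp
  | succ k ih =>
    rw [Finset.sum_range_succ, ← ih, ← add_assoc, h.im_succ, h.succ_eq]
    push_cast
    ring

theorem norm_sub_le_of_heightRatio_le (h : IsBackwardOrbit f w) {c : ℝ} (hc : 0 ≤ c) {n k : ℕ}
    (hk : ∀ i < k, heightRatio w (n + i) ≤ c) {q : ℂ}
    (hq : stepVec w n = (1 - heightRatio w n) * q)
    (hs : Summable fun i : ℕ =>
      c ^ i * ‖stepVec w (n + i) - (1 - heightRatio w (n + i)) * q‖) :
    ‖w (n + k + 1) - w (n + 1)‖ ≤ (w (n + 1)).im * ‖q‖ + (w n).im *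
      ∑' i : ℕ, c ^ i * ‖stepVec w (n + i) - (1 - heightRatio w (n + i)) * q‖ := by
  have hsum := h.add_sub_eq_sum q n (k + 1)
  -- By `hq` the first step follows the model exactly, so the base point may be moved to `n + 1`.
  have e1 : w n + (w n).im * q = w (n + 1) + (w (n + 1)).im * q := by
    rw [h.im_succ, h.succ_eq, hq]; push_cast; ring
  rw [e1, ← add_assoc] at hsum
  have e2 : w (n + k + 1) - w (n + 1) = (((w (n + 1)).im - (w (n + k + 1)).im : ℝ) : ℂ) * q +
      ∑ i ∈ Finset.range (k + 1),
        ((w (n + i)).im : ℂ) * (stepVec w (n + i) - (1 - heightRatio w (n + i)) * q) := by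
    rw [← hsum]; push_cast; ring
  rw [e2]
  refine (norm_add_le _ _).trans (add_le_add ?_ ?_)
  · rw [norm_mul, Complex.norm_real, Real.norm_eq_abs]
    have h1 : (w (n + k + 1)).im ≤ (w (n + 1)).im := h.im_antitone (by omega)
    have h2 := h.pos (n + k + 1)
    rw [abs_of_nonneg (by linarith)]
    gcongr
    linarith
  · refine (norm_sum_le _ _).trans ?_
    have h3 : ∀ i ∈ Finset.range (k + 1),
        ‖((w (n + i)).im : ℂ) * (stepVec w (n + i) - (1 - heightRatio w (n + i)) * q)‖ ≤
        (w n).im * (c ^ i * ‖stepVec w (n + i) - (1 - heightRatio w (n + i)) * q‖) := by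
      intro i hi
      rw [Finset.mem_range] at hi
      rw [norm_mul, Complex.norm_real, Real.norm_eq_abs, abs_of_pos (h.pos _), ← mul_assoc]
      gcongr
      exact h.im_add_le hc fun j hj => hk j (by omega)
    refine (Finset.sum_le_sum h3).trans ?_
    rw [← Finset.mul_sum]
    have := h.pos n
    gcongr
    exact hs.sum_le_tsum _ fun i _ => by positivity

/-- In `sq_norm_sub_le_mul` the rise of the ratio from at most `c` to above `c₁` gains the factor
`ρ`. Because (1/c_n - 1) y_{n+1} |q| = y_n |v_n|, the main term is exactly ρ y_n |v_n|. When `ρ <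
1`, and the relative height at `n + k` and `D` are small, v_n must be small. -/
theorem sub_mul_norm_stepVec_le (h : IsBackwardOrbit f w) {n k : ℕ} {c c₁ ρ D : ℝ} {q : ℂ}
    (hc₀ : 0 < c) (hc : c < c₁) (hc₁ : c₁ < 1)
    (hn : heightRatio w n ≤ c) (hk : c₁ < heightRatio w (n + k))
    (hρ : 0 ≤ ρ) (hρ2 : ρ ^ 2 = (c₁⁻¹ - 1) / (c⁻¹ - 1))
    (hq : stepVec w n = (1 - heightRatio w n) * q) (hD : 0 ≤ D)
    (hw : ‖w (n + k + 1) - w (n + 1)‖ ≤ (w (n + 1)).im * ‖q‖ + (w n).im * D) :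
    (1 - ρ) * ‖stepVec w n‖ ≤
      (w (n + k)).im / (w n).im * ‖stepVec w (n + k)‖ +
        ρ * ((heightRatio w n)⁻¹ - 1) * D := by
  have hcn := h.heightRatio_pos n
  have hck := h.heightRatio_pos (n + k)
  have hy := h.pos n
  have hκ : 0 < c⁻¹ - 1 := by
    have := (one_lt_inv₀ hc₀).mpr (hc.trans hc₁); linarith
  have hκn : c⁻¹ - 1 ≤ (heightRatio w n)⁻¹ - 1 := by
    have := inv_anti₀ hcn hn; linarith
  have hκ1 : 0 < c₁⁻¹ - 1 := by
    have := (one_lt_inv₀ (hc₀.trans hc)).mpr hc₁; linarith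
  have hκk : (heightRatio w (n + k))⁻¹ - 1 ≤ c₁⁻¹ - 1 := by
    have := inv_anti₀ (hc₀.trans hc) hk.le; linarith
  have key := h.sq_norm_sub_le_mul n (n + k)
  have h1 : ((heightRatio w n)⁻¹ - 1) * ((heightRatio w (n + k))⁻¹ - 1) ≤
      (ρ * ((heightRatio w n)⁻¹ - 1)) ^ 2 := by
    rw [mul_pow, hρ2]
    calc _ ≤ ((heightRatio w n)⁻¹ - 1) * (c₁⁻¹ - 1) := by gcongr; linarith
      _ = (c₁⁻¹ - 1) / (c⁻¹ - 1) * (((heightRatio w n)⁻¹ - 1) * (c⁻¹ - 1)) := by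
        rw [div_mul_eq_mul_div, eq_div_iff hκ.ne']
        ring
      _ ≤ _ := by
        rw [sq]
        gcongr
        linarith
  have hqn : ‖stepVec w n‖ = (1 - heightRatio w n) * ‖q‖ := by
    rw [hq, norm_mul]
    congr 1
    rw [← Complex.ofReal_one, ← Complex.ofReal_sub, Complex.norm_real, Real.norm_eq_abs,
      abs_of_nonneg]
    linarith [h.heightRatio_le_one n]
  have h2 : ‖(w n).im * stepVec w n - (w (n + k)).im * stepVec w (n + k)‖ ≤
      ρ * ((heightRatio w n)⁻¹ - 1) * ((w (n + 1)).im * ‖q‖ + (w n).im * D) := by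
    have hnn : 0 ≤ ρ * ((heightRatio w n)⁻¹ - 1) := mul_nonneg hρ (by linarith)
    have h1' := h.pos (n + 1)
    refine le_of_sq_le_sq ?_ (by positivity)
    rw [mul_pow]
    exact key.trans (mul_le_mul h1 (pow_le_pow_left₀ (norm_nonneg _) hw 2) (by positivity)
      (by positivity))
  have h3 : ‖(w n).im * stepVec w n‖ - ‖(w (n + k)).im * stepVec w (n + k)‖ ≤ _ :=
    (norm_sub_norm_le _ _).trans h2
  rw [norm_mul, norm_mul, Complex.norm_real, Complex.norm_real, Real.norm_eq_abs,
    Real.norm_eq_abs, abs_of_pos hy, abs_of_pos (h.pos _), h.im_succ] at h3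
  have h4 : ρ * ((heightRatio w n)⁻¹ - 1) * ((w n).im * heightRatio w n * ‖q‖ + (w n).im * D) =
      (w n).im * (ρ * ‖stepVec w n‖ + ρ * ((heightRatio w n)⁻¹ - 1) * D) := by
    rw [hqn]; field_simp
  rw [h4] at h3
  have h5 : (1 - ρ) * ‖stepVec w n‖ - ρ * ((heightRatio w n)⁻¹ - 1) * D ≤
      ((w (n + k)).im * ‖stepVec w (n + k)‖) / (w n).im := by
    rw [le_div_iff₀ hy]
    linarith
  rw [mul_div_right_comm] at h5
  linarith

end IsBackwardOrbit

/-! ### The height ratio tends to 1. -/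

namespace IsBackwardOrbit

variable {f : ℂ → ℂ} {w : ℕ → ℂ} {S : ℝ}

theorem norm_stepVec_sub_mul_le (n i : ℕ) {q : ℂ}
    (hq : stepVec w n = (1 - heightRatio w n) * q) :
    ‖stepVec w (n + i) - (1 - heightRatio w (n + i)) * q‖ ≤
      ‖stepVec w (n + i) - stepVec w n‖ + |heightRatio w (n + i) - heightRatio w n| * ‖q‖ := by
  have e : stepVec w (n + i) - (1 - heightRatio w (n + i)) * q =
      (stepVec w (n + i) - stepVec w n) +
        ((heightRatio w (n + i) - heightRatio w n : ℝ) : ℂ) * q := by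
    rw [hq]; push_cast; ring
  rw [e]
  refine (norm_add_le _ _).trans (le_of_eq ?_)
  rw [norm_mul, Complex.norm_real, Real.norm_eq_abs]

/-- Once the height ratio has been at most `c` it never again exceeds a given `c₁ > c`. -/
theorem eventually_heightRatio_le (h : IsBackwardOrbit f w)
    (hT : Tendsto (stepSinhSq w) atTop (𝓝 S)) (hS : 0 < S) {c c₁ : ℝ} (hc₀ : 0 < c) (hc : c < c₁)
    (hc₁ : c₁ < 1) :
    ∀ᶠ n in atTop, heightRatio w n ≤ c → ∀ k, heightRatio w (n + k) ≤ c₁ := by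
  by_contra hcon
  set A : Set ℕ := {n | heightRatio w n ≤ c ∧ ∃ k, c₁ < heightRatio w (n + k)} with hA
  have hfreq : ∃ᶠ n in atTop, n ∈ A := by
    rw [not_eventually] at hcon
    refine hcon.mono fun n hn => ?_
    push Not at hn
    exact hn
  set l : Filter ℕ := atTop ⊓ 𝓟 A with hl
  have : l.NeBot := frequently_mem_iff_neBot.mp hfreq
  have hle : l ≤ atTop := inf_le_left
  have hAl : ∀ᶠ n in l, n ∈ A := mem_inf_of_right (mem_principal_self A)
  -- First time after `n` at which the ratio exceeds `c₁`. Off `A` the infimum is 0 and `hK2` is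
  -- vacuous.
  set K : ℕ → ℕ := fun n => sInf {k | c₁ < heightRatio w (n + k)} with hK
  have hK1 : ∀ n ∈ A, c₁ < heightRatio w (n + K n) := fun n hn => Nat.sInf_mem hn.2
  have hK2 : ∀ n, ∀ i < K n, heightRatio w (n + i) ≤ c₁ := fun n i hi =>
    not_lt.mp (Nat.notMem_of_lt_sInf hi)
  set q : ℕ → ℂ := fun n => stepVec w n / (1 - heightRatio w n) with hqd
  have hq : ∀ n ∈ A, stepVec w n = (1 - heightRatio w n) * q n := by
    intro n hn
    have : (1 - heightRatio w n : ℂ) ≠ 0 := by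
      have h1 : (1 - heightRatio w n : ℝ) ≠ 0 := by linarith [hn.1]
      exact_mod_cast h1
    rw [hqd]; field_simp
  set V := Real.sqrt (4 * S) with hV
  have hVb := h.norm_stepVec_le hT
  set Q := V / (1 - c) with hQd
  have h1c : 0 < 1 - c := by linarith
  have hV0 : 0 ≤ V := Real.sqrt_nonneg _
  have hQ0 : 0 ≤ Q := by positivity
  have hQ : ∀ n ∈ A, ‖q n‖ ≤ Q := by
    intro n hn
    have e : ‖(1 - heightRatio w n : ℂ)‖ = 1 - heightRatio w n := by
      rw [← Complex.ofReal_one, ← Complex.ofReal_sub, Complex.norm_real, Real.norm_eq_abs,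
        abs_of_nonneg]
      linarith [hn.1]
    rw [hqd, norm_div, e]
    have := hn.1
    exact div_le_div₀ hV0 (hVb n) h1c (by linarith)
  have hc₁0 : 0 < c₁ := hc₀.trans hc
  set E : ℕ → ℕ → ℝ := fun n i =>
    c₁ ^ i * ‖stepVec w (n + i) - (1 - heightRatio w (n + i)) * q n‖ with hE
  have hgeo : Summable fun i : ℕ => c₁ ^ i * (V + Q) :=
    (summable_geometric_of_lt_one hc₁0.le hc₁).mul_right _
  have hEb : ∀ n ∈ A, ∀ i, ‖E n i‖ ≤ c₁ ^ i * (V + Q) := by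
    intro n hn i
    have h0 : 0 ≤ E n i := by positivity
    rw [Real.norm_eq_abs, abs_of_nonneg h0]
    refine mul_le_mul_of_nonneg_left ?_ (by positivity)
    refine (norm_sub_le _ _).trans (add_le_add (hVb _) ?_)
    rw [norm_mul, ← Complex.ofReal_one, ← Complex.ofReal_sub, Complex.norm_real,
      Real.norm_eq_abs, abs_of_nonneg (by linarith [h.heightRatio_le_one (n + i)])]
    refine (mul_le_of_le_one_left (norm_nonneg _) ?_).trans (hQ n hn)
    linarith [h.heightRatio_pos (n + i)]
  have hE0 : ∀ i, Tendsto (fun n => E n i) l (𝓝 0) := by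
    intro i
    have t1 := ((h.tendsto_stepVec_add_sub hT i).mono_left hle).norm
    have t2 := ((h.tendsto_heightRatio_add_sub hT i).mono_left hle).abs
    have t3 := (t1.add (t2.mul_const Q)).const_mul (c₁ ^ i)
    simp only [norm_zero, abs_zero, zero_mul, add_zero, mul_zero] at t3
    refine squeeze_zero' (Eventually.of_forall fun n => by positivity) ?_ t3
    filter_upwards [hAl] with n hn
    have := norm_stepVec_sub_mul_le n i (hq n hn)
    have hQn := hQ n hn
    simp only [hE]
    gcongr
    refine this.trans ?_
    gcongr
  have hD : Tendsto (fun n => ∑' i, E n i) l (𝓝 0) := by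
    have := tendsto_tsum_of_dominated_convergence (𝓕 := l) (f := E) (g := fun _ => 0) hgeo hE0
      (hAl.mono hEb)
    simpa using this
  -- For each fixed `i` the ratio changes by o(1) over `i` steps, so climbing the gap `c₁ - c` takes
  -- ever longer; meanwhile the heights shrink by `c₁` at each step.
  have hKt : Tendsto K l atTop := by
    rw [tendsto_atTop]
    intro J
    have hsmall : ∀ᶠ n in l, ∀ i ∈ Finset.range J,
        heightRatio w (n + i) - heightRatio w n < c₁ - c := by
      rw [Filter.eventually_all_finset]
      intro i _
      exact ((h.tendsto_heightRatio_add_sub hT i).mono_left hle).eventually_lt_const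
        (by linarith)
    filter_upwards [hsmall, hAl] with n hn hnA
    by_contra hlt
    have h1 := hn (K n) (Finset.mem_range.mpr (not_le.mp hlt))
    linarith [hK1 n hnA, hnA.1]
  have hg : Tendsto (fun n => (w (n + K n)).im / (w n).im) l (𝓝 0) := by
    refine squeeze_zero (fun n => div_nonneg (h.pos _).le (h.pos _).le) (fun n => ?_)
      ((tendsto_pow_atTop_nhds_zero_of_lt_one hc₁0.le hc₁).comp hKt)
    rw [div_le_iff₀ (h.pos n), mul_comm]
    exact h.im_add_le hc₁0.le (hK2 n)
  have hκ : 0 < c⁻¹ - 1 := by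
    have := (one_lt_inv₀ hc₀).mpr (hc.trans hc₁); linarith
  have hκ1 : 0 < c₁⁻¹ - 1 := by
    have := (one_lt_inv₀ hc₁0).mpr hc₁; linarith
  have hκlt : c₁⁻¹ - 1 < c⁻¹ - 1 := by
    have := inv_strictAnti₀ hc₀ hc; linarith
  set ρ := Real.sqrt ((c₁⁻¹ - 1) / (c⁻¹ - 1)) with hρ
  have hρ2 : ρ ^ 2 = (c₁⁻¹ - 1) / (c⁻¹ - 1) := Real.sq_sqrt (by positivity)
  have hρ1 : ρ < 1 := by
    rw [hρ, Real.sqrt_lt' one_pos, one_pow, div_lt_one hκ]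
    exact hκlt
  have hρ0 : 0 ≤ ρ := Real.sqrt_nonneg _
  have hlim : Tendsto (fun n => (w (n + K n)).im / (w n).im * V +
      (4 * S + 2) * ∑' i, E n i) l (𝓝 0) := by
    simpa using (hg.mul_const V).add (hD.const_mul (4 * S + 2))
  have hsmall : Tendsto (fun n => (1 - ρ) * ‖stepVec w n‖) l (𝓝 0) := by
    refine squeeze_zero' (Eventually.of_forall fun n =>
      mul_nonneg (by linarith) (norm_nonneg _)) ?_ hlim
    filter_upwards [hAl] with n hn
    have hsum : Summable (E n) := Summable.of_norm_bounded hgeo (hEb n hn)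
    have hw := h.norm_sub_le_of_heightRatio_le hc₁0.le (hK2 n) (hq n hn) hsum
    have hDn : 0 ≤ ∑' i, E n i := tsum_nonneg fun i => by positivity
    refine (h.sub_mul_norm_stepVec_le hc₀ hc hc₁ hn.1 (hK1 n hn) hρ0 hρ2 (hq n hn) hDn hw).trans ?_
    have h1 := div_pos (h.pos (n + K n)) (h.pos n)
    have h2 := hVb (n + K n)
    have h3 : (heightRatio w n)⁻¹ ≤ 4 * S + 2 := by
      rw [inv_le_comm₀ (h.heightRatio_pos n) (by positivity)]
      exact h.inv_le_heightRatio hT n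
    have h4 : 0 ≤ (heightRatio w n)⁻¹ - 1 := by
      have := (one_le_inv₀ (h.heightRatio_pos n)).mpr (h.heightRatio_le_one n); linarith
    gcongr
    calc _ ≤ 1 * ((heightRatio w n)⁻¹ - 1) := by gcongr
      _ ≤ _ := by linarith
  have hlow : Tendsto (fun n => 4 * (4 * S + 2)⁻¹ * stepSinhSq w n) l
      (𝓝 (4 * (4 * S + 2)⁻¹ * S)) := (hT.mono_left hle).const_mul _
  have hsq : Tendsto (fun n => ‖stepVec w n‖ ^ 2) l (𝓝 0) := by
    have := (hsmall.const_mul (1 - ρ)⁻¹).pow 2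
    simp only [mul_zero, ne_eq, OfNat.ofNat_ne_zero, not_false_eq_true, zero_pow] at this
    refine this.congr fun n => ?_
    rw [inv_mul_cancel_left₀ (by linarith)]
  have := le_of_tendsto_of_tendsto hlow hsq (Eventually.of_forall fun n => by
    change _ ≤ ‖stepVec w n‖ ^ 2
    rw [h.norm_stepVec_sq]
    exact mul_le_mul_of_nonneg_right
      (mul_le_mul_of_nonneg_left (h.inv_le_heightRatio hT n) (by norm_num))
      (h.stepSinhSq_nonneg n))
  have h5 : 0 < 4 * (4 * S + 2)⁻¹ * S := by positivity
  linarith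

/-- A ratio at most `c < 1` at arbitrarily late times would stay at most (c + 1)/2 from some time
on. Steps are bounded multiples of the heights, so the orbit would be Cauchy. -/
theorem tendsto_heightRatio (h : IsBackwardOrbit f w)
    (hT : Tendsto (stepSinhSq w) atTop (𝓝 S)) (hS : 0 < S)
    (hinf : Tendsto w atTop (Bornology.cobounded ℂ)) :
    Tendsto (heightRatio w) atTop (𝓝 1) := by
  rw [tendsto_order]
  refine ⟨fun c hc => ?_, fun c hc => Eventually.of_forall fun n =>
    (h.heightRatio_le_one n).trans_lt hc⟩
  rcases le_or_gt c 0 with hc0 | hc0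
  · exact Eventually.of_forall fun n => hc0.trans_lt (h.heightRatio_pos n)
  by_contra hcon
  rw [not_eventually] at hcon
  have hm1 : c < (c + 1) / 2 := by linarith
  have hm2 : (c + 1) / 2 < 1 := by linarith
  obtain ⟨N, hN, hN'⟩ := (hcon.and_eventually (h.eventually_heightRatio_le hT hS hc0 hm1 hm2)).exists
  have hr := hN' (not_lt.mp hN)
  have hC : CauchySeq fun k => w (N + k) := by
    refine cauchySeq_of_le_geometric ((c + 1) / 2) ((w N).im * Real.sqrt (4 * S)) hm2 fun k => ?_
    rw [dist_comm, dist_eq_norm, ← add_assoc, h.succ_eq (N + k), add_sub_cancel_left, norm_mul,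
      Complex.norm_real, Real.norm_eq_abs, abs_of_pos (h.pos _), mul_right_comm]
    have h1 := h.im_add_le (c := (c + 1) / 2) (by linarith) (n := N) (k := k) fun i _ => hr i
    exact mul_le_mul h1 (h.norm_stepVec_le hT _) (norm_nonneg _) ((h.pos _).le.trans h1)
  obtain ⟨z, hz⟩ := cauchySeq_tendsto_of_complete hC
  have hinf' : Tendsto (fun k => ‖w (N + k)‖) atTop atTop := by
    have := (tendsto_norm_atTop_iff_cobounded.mpr hinf).comp (tendsto_add_atTop_nat N)
    refine this.congr fun k => ?_
    simp [add_comm]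
  exact not_tendsto_atTop_of_tendsto_nhds hz.norm hinf'

end IsBackwardOrbit

theorem IsParabolicSelfMap.isBackwardOrbit {φ : ℂ → ℂ} (hφ : IsParabolicSelfMap φ) {w : ℕ → ℂ}
    (hw : IsBackwardIteration φ w) : IsBackwardOrbit φ w :=
  ⟨hφ.increasesIm, hw.mem, hw.map_succ⟩

/-! ### The limit of the rescaled steps. -/

namespace IsBackwardOrbit

variable {f : ℂ → ℂ} {w : ℕ → ℂ} {S : ℝ}

theorem limit_pos (h : IsBackwardOrbit f w) (hT : Tendsto (stepSinhSq w) atTop (𝓝 S))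
    (hinf : Tendsto w atTop (Bornology.cobounded ℂ)) : 0 < S := by
  by_contra hS
  have h0 : ∀ n, stepSinhSq w n = 0 := fun n =>
    le_antisymm ((h.stepSinhSq_le hT n).trans (not_lt.mp hS)) (h.stepSinhSq_nonneg n)
  have h1 : ∀ n, w n = w 0 := by
    intro n
    induction n with
    | zero => rfl
    | succ n ih =>
      have h2 := h.norm_stepVec_sq n
      rw [h0, mul_zero, sq_eq_zero_iff, norm_eq_zero] at h2
      rw [h.succ_eq, h2, mul_zero, add_zero, ih]
  have h3 := tendsto_norm_atTop_iff_cobounded.mpr hinf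
  simp only [h1] at h3
  exact not_tendsto_atTop_of_tendsto_nhds tendsto_const_nhds h3

theorem tendsto_re (h : IsBackwardOrbit f w) (hinf : Tendsto w atTop (Bornology.cobounded ℂ))
    (harg : Tendsto (fun n => (w n).arg) atTop (𝓝 0)) :
    Tendsto (fun n => (w n).re) atTop atTop := by
  have h1 := tendsto_norm_atTop_iff_cobounded.mpr hinf
  have h2 : Tendsto (fun n => ‖w n‖ + -(w 0).im) atTop atTop :=
    tendsto_atTop_add_const_right _ _ h1
  refine tendsto_atTop_mono' _ ?_ h2
  filter_upwards [harg.eventually_lt_const (u := Real.pi / 2) (by positivity)] with n hn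
  have h3 : 0 ≤ (w n).re := by
    have h4 := Complex.arg_nonneg_iff.mpr (h.pos n).le
    exact Complex.abs_arg_le_pi_div_two_iff.mp (by rw [abs_of_nonneg h4]; exact hn.le)
  have h5 := Complex.norm_le_abs_re_add_abs_im (w n)
  rw [abs_of_nonneg h3, abs_of_pos (h.pos n)] at h5
  have := h.im_antitone (Nat.zero_le n)
  simp only at this
  linarith

/-- c_n → 1 gives Im v_n → 0 and |Re v_n| → b > 0. Eventually |Re v_n| > b/2 while consecutive
values differ by less than b/2, so the sign is constant; a nonpositive sign would bound Re w_n
above. -/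
theorem tendsto_stepVec (h : IsBackwardOrbit f w) (hT : Tendsto (stepSinhSq w) atTop (𝓝 S))
    (hinf : Tendsto w atTop (Bornology.cobounded ℂ))
    (harg : Tendsto (fun n => (w n).arg) atTop (𝓝 0)) :
    Tendsto (stepVec w) atTop (𝓝 (Real.sqrt (4 * S) : ℂ)) := by
  have hS := h.limit_pos hT hinf
  have hc := h.tendsto_heightRatio hT hS hinf
  have him : Tendsto (fun n => (stepVec w n).im) atTop (𝓝 0) := by
    have := hc.sub_const 1
    rw [sub_self] at this
    refine this.congr fun n => ?_
    rw [h.heightRatio_eq]; ring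
  have hsq : Tendsto (fun n => (stepVec w n).re ^ 2) atTop (𝓝 (4 * S)) := by
    have h1 := ((hc.const_mul 4).mul hT).sub (him.pow 2)
    simp only [mul_one, ne_eq, OfNat.ofNat_ne_zero, not_false_eq_true, zero_pow, sub_zero] at h1
    refine h1.congr fun n => ?_
    rw [← h.norm_stepVec_sq, Complex.sq_norm, Complex.normSq_apply]
    ring
  have habs : Tendsto (fun n => |(stepVec w n).re|) atTop (𝓝 (Real.sqrt (4 * S))) := by
    refine hsq.sqrt.congr fun n => Real.sqrt_sq_eq_abs _
  set b := Real.sqrt (4 * S) with hb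
  have hb0 : 0 < b := Real.sqrt_pos.mpr (by linarith)
  have hdiff : Tendsto (fun n => |(stepVec w (n + 1)).re - (stepVec w n).re|) atTop (𝓝 0) := by
    have := ((Complex.continuous_re.tendsto _).comp (h.tendsto_stepVec_succ_sub hT)).abs
    simpa using this
  have hev := (habs.eventually_const_lt (u := b / 2) (by linarith)).and
    (hdiff.eventually_lt_const (u := b / 2) (by linarith))
  obtain ⟨N, hN⟩ := eventually_atTop.mp hev
  have hxt := h.tendsto_re hinf harg
  have hpos : ∃ m ≥ N, 0 < (stepVec w m).re := by
    by_contra hneg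
    push Not at hneg
    have hle : ∀ k, (w (N + k)).re ≤ (w N).re := by
      intro k
      induction k with
      | zero => rfl
      | succ k ih =>
        rw [← add_assoc, h.succ_eq, Complex.add_re, Complex.re_ofReal_mul]
        have h1 := hneg (N + k) (by omega)
        have h2 := h.pos (N + k)
        nlinarith
    obtain ⟨m, hm⟩ := ((hxt.eventually_gt_atTop (w N).re).and (eventually_ge_atTop N)).exists
    have := hle (m - N)
    rw [Nat.add_sub_cancel' hm.2] at this
    linarith [hm.1]
  obtain ⟨m, hmN, hm⟩ := hpos
  have hall : ∀ n ≥ m, 0 < (stepVec w n).re := by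
    intro n hn
    induction n, hn using Nat.le_induction with
    | base => exact hm
    | succ n hn ih =>
      have h1 := hN n (by omega)
      have h2 := (abs_lt.mp h1.2).1
      rw [abs_of_pos ih] at h1
      linarith [h1.1]
  have hre : Tendsto (fun n => (stepVec w n).re) atTop (𝓝 b) := by
    refine habs.congr' ?_
    filter_upwards [eventually_ge_atTop m] with n hn
    exact abs_of_pos (hall n hn)
  have := ((Complex.continuous_ofReal.tendsto _).comp hre).add
    (((Complex.continuous_ofReal.tendsto _).comp him).mul_const Complex.I)
  simp only [Complex.ofReal_zero, zero_mul, add_zero] at this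
  exact this.congr fun n => Complex.re_add_im _

theorem tendsto_deriv (h : IsBackwardOrbit f w) (hc : Tendsto (heightRatio w) atTop (𝓝 1)) :
    Tendsto (fun n => deriv f (w n)) atTop (𝓝 1) := by
  rw [← tendsto_add_atTop_iff_nat 1, tendsto_iff_norm_sub_tendsto_zero]
  have h1 := (hc.inv₀ one_ne_zero).sub_const 1
  rw [inv_one, sub_self] at h1
  refine squeeze_zero (fun n => norm_nonneg _) (fun n => ?_) h1
  have h2 := h.inc.norm_deriv_sub_one_le (h.pos (n + 1))
  rwa [h.map, sub_div, div_self (h.pos _).ne', ← inv_div] at h2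

end IsBackwardOrbit

theorem stepTranslation_eq_sqrt {a : ℝ} (ha0 : 0 ≤ a) :
    stepTranslation a = Real.sqrt (4 * (a ^ 2 / (1 - a ^ 2))) := by
  have : 4 * (a ^ 2 / (1 - a ^ 2)) = (2 * a) ^ 2 / (1 - a ^ 2) := by ring
  rw [stepTranslation, this, Real.sqrt_div (sq_nonneg _), Real.sqrt_sq (by linarith)]

theorem IsBackwardIteration.tendsto_stepSinhSq {φ : ℂ → ℂ} {w : ℕ → ℂ}
    (hw : IsBackwardIteration φ w) {a : ℝ} (ha0 : 0 ≤ a) (ha : a < 1)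
    (hstep : Tendsto (fun n => pseudoHypDist (w n) (w (n + 1))) atTop (𝓝 a)) :
    Tendsto (stepSinhSq w) atTop (𝓝 (a ^ 2 / (1 - a ^ 2))) := by
  have h1 : 1 - a ^ 2 ≠ 0 := by nlinarith
  refine ((hstep.pow 2).div ((hstep.pow 2).const_sub 1) h1).congr fun n => ?_
  exact pseudoHypDist_sq_div (hw.mem n) (hw.mem (n + 1))

/-! ### Rigidity of self-maps fixing I, and local bounds. -/

/-- The Cayley transform of the upper half-plane onto the unit disk. -/
noncomputable def cayley (z : ℂ) : ℂ := (z - Complex.I) / (z + Complex.I)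

theorem add_I_ne_zero {z : ℂ} (hz : 0 < z.im) : z + Complex.I ≠ 0 := by
  intro h
  have := congrArg Complex.im h
  simp at this
  linarith

theorem cayley_I : cayley Complex.I = 0 := by simp [cayley]

theorem cayley_ne_zero {z : ℂ} (hz : 0 < z.im) (hne : z ≠ Complex.I) : cayley z ≠ 0 :=
  div_ne_zero (sub_ne_zero.mpr hne) (add_I_ne_zero hz)

theorem norm_cayley_le_one {z : ℂ} (hz : 0 < z.im) : ‖cayley z‖ ≤ 1 := by
  have h := norm_sub_lt_norm_sub_conj hz (w := Complex.I) (by simp)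
  rw [Complex.conj_I, sub_neg_eq_add] at h
  rw [cayley, norm_div]
  exact div_le_one_of_le₀ h.le (norm_nonneg _)

theorem norm_cayley_map_le {G : ℂ → ℂ} (hd : DifferentiableOn ℂ G {z | 0 < z.im})
    (hG : ∀ z : ℂ, 0 < z.im → 0 < (G z).im) (hI : G Complex.I = Complex.I) {z : ℂ}
    (hz : 0 < z.im) : ‖cayley (G z)‖ ≤ ‖cayley z‖ := by
  have hIm : 0 < Complex.I.im := by simp
  have key := schwarzPick_of_pos hd hG hz hIm
  rw [hI] at key
  have h1 := norm_sub_conj_sq z Complex.I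
  have h2 := norm_sub_conj_sq (G z) Complex.I
  rw [Complex.conj_I, sub_neg_eq_add] at h1 h2
  have p1 : 0 < ‖z + Complex.I‖ := norm_pos_iff.mpr (add_I_ne_zero hz)
  have p2 : 0 < ‖G z + Complex.I‖ := norm_pos_iff.mpr (add_I_ne_zero (hG z hz))
  rw [cayley, cayley, norm_div, norm_div, div_le_div_iff₀ p2 p1]
  refine le_of_sq_le_sq ?_ (by positivity)
  rw [mul_pow, mul_pow, h1, h2]
  simp only [Complex.I_im, mul_one] at key ⊢
  nlinarith

/-- If a self-map of the upper half-plane fixes `I` and nearly fixes `s`, it is close to the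
identity. -/
theorem norm_cayley_map_sub_le {G : ℂ → ℂ} (hd : DifferentiableOn ℂ G {z | 0 < z.im})
    (hG : ∀ z : ℂ, 0 < z.im → 0 < (G z).im) (hI : G Complex.I = Complex.I) {z s : ℂ}
    (hz : 0 < z.im) (hs : 0 < s.im) (hsI : s ≠ Complex.I) :
    ‖cayley (G z) - cayley z‖ ≤ ‖1 - cayley (G s) / cayley s‖ +
      Real.sqrt (2 * ‖1 - cayley (G s) / cayley s‖ * (‖z - s‖ ^ 2 / (z.im * s.im))) := by
  have hIm : 0 < Complex.I.im := by simp
  -- The quotient `cayley (G z) / cayley z`, continued analytically across `I`; the Schwarz lemma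
  -- bounds it by 1.
  set h : ℂ → ℂ := fun z => dslope (fun z => cayley (G z)) Complex.I z * (z + Complex.I) with hh
  have hcd : DifferentiableOn ℂ (fun z => cayley (G z)) {z | 0 < z.im} :=
    (hd.sub_const _).div (hd.add_const _) fun z hz => add_I_ne_zero (hG z hz)
  have hhd : DifferentiableOn ℂ h {z | 0 < z.im} :=
    ((Complex.differentiableOn_dslope (isOpen_im_pos.mem_nhds hIm)).mpr hcd).mul
      (differentiableOn_id.add_const _)
  have hval : ∀ z : ℂ, 0 < z.im → h z * cayley z = cayley (G z) := by
    intro z hz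
    by_cases hzI : z = Complex.I
    · rw [hzI, hI, cayley_I, mul_zero]
    · have h1 := sub_ne_zero.mpr hzI
      have h2 := add_I_ne_zero hz
      simp only [hh]
      rw [dslope_of_ne _ hzI, slope_def_field, hI, cayley_I, sub_zero]
      simp only [cayley]
      field_simp
  have hle' : ∀ z : ℂ, 0 < z.im → z ≠ Complex.I → ‖h z‖ ≤ 1 := by
    intro z hz hzI
    have h1 := norm_cayley_map_le hd hG hI hz
    rw [← hval z hz, norm_mul] at h1
    exact le_of_mul_le_mul_right (by rwa [one_mul]) (norm_pos_iff.mpr (cayley_ne_zero hz hzI))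
  have hle : ∀ z : ℂ, 0 < z.im → ‖h z‖ ≤ 1 := by
    intro z hz
    by_cases hzI : z = Complex.I
    · have hc : Tendsto (fun z => ‖h z‖) (𝓝[≠] Complex.I) (𝓝 ‖h Complex.I‖) :=
        ((hhd.differentiableAt (isOpen_im_pos.mem_nhds hIm)).continuousAt.norm.tendsto).mono_left
          nhdsWithin_le_nhds
      rw [hzI]
      refine le_of_tendsto hc ?_
      have hev : ∀ᶠ z in 𝓝[≠] Complex.I, 0 < z.im :=
        nhdsWithin_le_nhds (isOpen_im_pos.mem_nhds hIm)
      filter_upwards [hev, self_mem_nhdsWithin] with z hz hzI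
      exact hle' z hz hzI
    · exact hle' z hz hzI
  have him : ∀ z, (Complex.I * (1 - h z)).im = 1 - (h z).re := fun z => by simp
  -- As |h| ≤ 1, `I * (1 - h)` maps into the closed half-plane, so smallness of 1 - h at `s`
  -- propagates to `z`.
  have hsp := schwarzPick (f := fun z => Complex.I * (1 - h z))
    ((hhd.const_sub 1).const_mul _) (fun z hz => by
      rw [him]
      linarith [(Complex.re_le_norm (h z)).trans (hle z hz)]) hz hs
  simp only [him] at hsp
  have e1 : ‖Complex.I * (1 - h z) - Complex.I * (1 - h s)‖ = ‖h s - h z‖ := by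
    rw [← mul_sub, norm_mul, Complex.norm_I, one_mul]
    congr 1; ring
  rw [e1] at hsp
  have hhs : cayley (G s) / cayley s = h s := by
    rw [← hval s hs, mul_div_cancel_right₀ _ (cayley_ne_zero hs hsI)]
  rw [hhs]
  have b1 : 1 - (h z).re ≤ 2 := by
    have := (Complex.abs_re_le_norm (h z)).trans (hle z hz)
    linarith [(abs_le.mp this).1]
  have b1' : 0 ≤ 1 - (h z).re := by
    linarith [(Complex.re_le_norm (h z)).trans (hle z hz)]
  have b2 : 1 - (h s).re ≤ ‖1 - h s‖ := by
    simpa using Complex.re_le_norm (1 - h s)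
  have b2' : 0 ≤ 1 - (h s).re := by
    linarith [(Complex.re_le_norm (h s)).trans (hle s hs)]
  have hp := mul_pos hz hs
  have b3 : ‖h s - h z‖ ≤ Real.sqrt (2 * ‖1 - h s‖ * (‖z - s‖ ^ 2 / (z.im * s.im))) := by
    apply Real.le_sqrt_of_sq_le
    rw [← mul_div_assoc, le_div_iff₀ hp]
    refine hsp.trans ?_
    gcongr
  have e2 : cayley (G z) - cayley z = -((1 - h s) + (h s - h z)) * cayley z := by
    rw [← hval z hz]; ring
  rw [e2, norm_mul, norm_neg]
  calc _ ≤ ‖1 - h s + (h s - h z)‖ * 1 := by gcongr; exact norm_cayley_le_one hz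
    _ ≤ ‖1 - h s‖ + ‖h s - h z‖ := by rw [mul_one]; exact norm_add_le _ _
    _ ≤ _ := by gcongr

theorem norm_sub_le_of_norm_cayley_sub_le {z z' : ℂ} (hz : 0 < z.im) (hz' : 0 < z'.im)
    {e R : ℝ} (he : ‖cayley z' - cayley z‖ ≤ e) (hR : ‖z + Complex.I‖ ≤ R) (heR : e * R ≤ 1) :
    ‖z' - z‖ ≤ e * R ^ 2 := by
  have h1 := add_I_ne_zero hz
  have h2 := add_I_ne_zero hz'
  have e1 : cayley z' - cayley z =
      2 * Complex.I * (z' - z) / ((z' + Complex.I) * (z + Complex.I)) := by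
    rw [cayley, cayley, div_sub_div _ _ h2 h1]
    congr 1; ring
  rw [e1, norm_div, norm_mul, norm_mul, norm_mul, Complex.norm_I, Complex.norm_two, mul_one,
    div_le_iff₀ (by positivity)] at he
  have h3 : ‖z' + Complex.I‖ ≤ ‖z' - z‖ + R := by
    have e2 : z' + Complex.I = (z' - z) + (z + Complex.I) := by ring
    rw [e2]
    exact (norm_add_le _ _).trans (by gcongr)
  have hR0 : 0 < R := (norm_pos_iff.mpr h1).trans_le hR
  have he0 : 0 ≤ e := by
    have : 0 < ‖z' + Complex.I‖ * ‖z + Complex.I‖ := by positivity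
    exact nonneg_of_mul_nonneg_left ((by positivity : 0 ≤ 2 * ‖z' - z‖).trans he) this
  have h4 : 2 * ‖z' - z‖ ≤ e * ((‖z' - z‖ + R) * R) := he.trans (by gcongr)
  nlinarith [norm_nonneg (z' - z)]

/-- The bound of `norm_cayley_map_sub_le` depends on `G` only through `s` and `G s`, and it vanishes
continuously as both tend to `σ`; hence `ρ` is uniform in `G`. -/
theorem exists_forall_norm_map_sub_lt {σ : ℂ} (hσ : 0 < σ.im) (hσI : σ ≠ Complex.I) {R δ ε : ℝ}
    (hR : 0 < R) (hδ : 0 < δ) (hε : 0 < ε) :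
    ∃ ρ > 0, ∀ (G : ℂ → ℂ) (s : ℂ), DifferentiableOn ℂ G {z | 0 < z.im} →
      (∀ z : ℂ, 0 < z.im → 0 < (G z).im) → G Complex.I = Complex.I →
      dist s σ < ρ → dist (G s) σ < ρ → ∀ z : ℂ, ‖z‖ ≤ R → δ ≤ z.im → ‖G z - z‖ < ε := by
  set e : ℂ × ℂ → ℝ := fun p => ‖1 - cayley p.2 / cayley p.1‖ +
    Real.sqrt (2 * ‖1 - cayley p.2 / cayley p.1‖ * ((R + ‖p.1‖) ^ 2 / (δ * p.1.im))) with he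
  have hcσ : ContinuousAt cayley σ := by
    unfold cayley
    exact (continuousAt_id.sub continuousAt_const).div (continuousAt_id.add continuousAt_const)
      (add_I_ne_zero hσ)
  have hc1 : ContinuousAt (fun p : ℂ × ℂ => cayley p.1) (σ, σ) :=
    ContinuousAt.comp (g := cayley) (f := Prod.fst) (x := (σ, σ)) hcσ continuousAt_fst
  have hc2 : ContinuousAt (fun p : ℂ × ℂ => cayley p.2) (σ, σ) :=
    ContinuousAt.comp (g := cayley) (f := Prod.snd) (x := (σ, σ)) hcσ continuousAt_snd
  have hη : ContinuousAt (fun p : ℂ × ℂ => ‖1 - cayley p.2 / cayley p.1‖) (σ, σ) :=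
    (continuousAt_const.sub (hc2.div hc1 (cayley_ne_zero hσ hσI))).norm
  have hσδ : δ * σ.im ≠ 0 := by positivity
  have hec : ContinuousAt e (σ, σ) := by
    refine hη.add (Real.continuous_sqrt.continuousAt.comp
      ((continuousAt_const.mul hη).mul (ContinuousAt.div ?_ ?_ hσδ)))
    · fun_prop
    · fun_prop
  have he0 : e (σ, σ) = 0 := by
    simp [he, div_self (cayley_ne_zero hσ hσI)]
  have hec' : Tendsto e (𝓝 (σ, σ)) (𝓝 0) := he0 ▸ hec.tendsto
  have hev1 : ∀ᶠ p in 𝓝 (σ, σ), e p < min (1 / (R + 1)) (ε / (R + 1) ^ 2) :=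
    hec'.eventually_lt_const (by positivity)
  have hev0 : ∀ᶠ z in 𝓝 σ, 0 < z.im := isOpen_im_pos.mem_nhds hσ
  have hev2 : ∀ᶠ p : ℂ × ℂ in 𝓝 (σ, σ), 0 < p.1.im ∧ p.1 ≠ Complex.I :=
    (continuous_fst.tendsto (σ, σ)).eventually (hev0.and (eventually_ne_nhds hσI))
  obtain ⟨ρ, hρ, H⟩ := Metric.eventually_nhds_iff.mp (hev1.and hev2)
  refine ⟨ρ, hρ, fun G s hd hG hI hs ht z hzR hzδ => ?_⟩
  obtain ⟨h1, hs0, hsI⟩ := H (y := (s, G s)) (by rw [Prod.dist_eq]; exact max_lt hs ht)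
  have hz : 0 < z.im := hδ.trans_le hzδ
  simp only at hs0 hsI
  have h2 : ‖cayley (G z) - cayley z‖ ≤ e (s, G s) := by
    refine (norm_cayley_map_sub_le hd hG hI hz hs0 hsI).trans ?_
    simp only [he]
    have : ‖z - s‖ ≤ R + ‖s‖ := (norm_sub_le _ _).trans (by gcongr)
    gcongr
  have hR1 : ‖z + Complex.I‖ ≤ R + 1 := by
    refine (norm_add_le _ _).trans ?_
    rw [Complex.norm_I]
    linarith
  have h3 := h1.trans_le (min_le_left _ _)
  have h4 := h1.trans_le (min_le_right _ _)
  rw [lt_div_iff₀ (by positivity)] at h3 h4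
  exact (norm_sub_le_of_norm_cayley_sub_le hz (hG z hz) h2 hR1 h3.le).trans_lt h4

theorem norm_le_of_mapsTo {f : ℂ → ℂ} (hd : DifferentiableOn ℂ f {z | 0 < z.im})
    (hf : ∀ z : ℂ, 0 < z.im → 0 ≤ (f z).im) {R δ : ℝ} (hδ : 0 < δ) {z : ℂ} (hz : ‖z‖ ≤ R)
    (hz' : δ ≤ z.im) : ‖f z‖ ≤ ‖f Complex.I‖ * ((R + 1) ^ 2 / δ + 2) := by
  have hz0 : 0 < z.im := hδ.trans_le hz'
  have hI : 0 < Complex.I.im := by simp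
  have key := schwarzPick hd hf hz0 hI
  rw [Complex.I_im, mul_one, ← le_div_iff₀ hz0] at key
  set X := ‖f z - f Complex.I‖ with hX
  set p := ‖f Complex.I‖ with hp
  have hp0 : 0 ≤ p := norm_nonneg _
  have hX0 : 0 ≤ X := norm_nonneg _
  have hN : ‖z - Complex.I‖ ^ 2 / z.im ≤ (R + 1) ^ 2 / δ := by
    have : ‖z - Complex.I‖ ≤ R + 1 := by
      refine (norm_sub_le _ _).trans ?_
      rw [Complex.norm_I]; linarith
    gcongr
  set N := (R + 1) ^ 2 / δ with hNd
  have hN0 : 0 ≤ N := by positivity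
  have h1 : ‖f z‖ ≤ X + p := by
    have : f z = (f z - f Complex.I) + f Complex.I := by ring
    rw [this]
    exact norm_add_le _ _
  have h2 : (f z).im ≤ X + p := (Complex.im_le_norm _).trans h1
  have h3 : (f Complex.I).im ≤ p := Complex.im_le_norm _
  have h4 : X ^ 2 ≤ (X + p) * p * N := by
    refine key.trans ?_
    rw [mul_div_assoc]
    have := hf z hz0
    have := hf _ hI
    gcongr
  have h5 : X ≤ p * (N + 1) := by
    by_contra hcon
    rw [not_le] at hcon
    nlinarith [mul_nonneg hp0 hN0]
  linarith

/-- The Lipschitz constant depends on `f` only through its value at `I`. The normalized iterates all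
send `I` to `w 0`, so they share one constant. -/
theorem norm_map_sub_le {f : ℂ → ℂ} (hd : DifferentiableOn ℂ f {z | 0 < z.im})
    (hf : ∀ z : ℂ, 0 < z.im → 0 ≤ (f z).im) {R δ : ℝ} (hδ : 0 < δ) {z z' : ℂ}
    (hz : ‖z‖ ≤ R) (hzδ : δ ≤ z.im) (hz' : ‖z'‖ ≤ R) (hzδ' : δ ≤ z'.im) :
    ‖f z - f z'‖ ≤ ‖f Complex.I‖ * ((R + 1) ^ 2 / δ + 2) / δ * ‖z - z'‖ := by
  have b1 := (Complex.im_le_norm _).trans (norm_le_of_mapsTo hd hf hδ hz hzδ)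
  have b2 := (Complex.im_le_norm _).trans (norm_le_of_mapsTo hd hf hδ hz' hzδ')
  have h0 : 0 < z.im := hδ.trans_le hzδ
  have h0' : 0 < z'.im := hδ.trans_le hzδ'
  have key := schwarzPick hd hf h0 h0'
  have n1 := hf z h0
  have n2 := hf z' h0'
  set B := ‖f Complex.I‖ * ((R + 1) ^ 2 / δ + 2) with hB
  have hB0 : 0 ≤ B := by positivity
  refine le_of_sq_le_sq ?_ (by positivity)
  rw [mul_pow, div_pow, div_mul_eq_mul_div, le_div_iff₀ (by positivity)]
  calc _ ≤ ‖f z - f z'‖ ^ 2 * (z.im * z'.im) := by rw [sq δ]; gcongr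
    _ ≤ _ := key
    _ ≤ _ := by rw [sq B]; gcongr

theorem IsCompact.exists_norm_le_and_le_im {K : Set ℂ} (hK : IsCompact K)
    (hKH : K ⊆ {z | 0 < z.im}) : ∃ R > 0, ∃ δ > 0, ∀ z ∈ K, ‖z‖ ≤ R ∧ δ ≤ z.im := by
  obtain ⟨R, hR, hKR⟩ := hK.isBounded.exists_pos_norm_le
  obtain ⟨δ, hδ, hKδ⟩ := hK.exists_forall_le' (a := 0) Complex.continuous_im.continuousOn hKH
  exact ⟨R, hR, δ, hδ, fun z hz => ⟨hKR z hz, hKδ z hz⟩⟩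

/-! ### Normalized iterates and the conjugation ψ. -/

/-- The inverse of `normAut p`. -/
noncomputable def normAutInv (p z : ℂ) : ℂ := (z - (p.re : ℂ)) / (p.im : ℂ)

theorem normAut_im (p z : ℂ) : (normAut p z).im = p.im * z.im := by
  simp [normAut]

theorem normAutInv_im (p z : ℂ) : (normAutInv p z).im = z.im / p.im := by
  simp [normAutInv, Complex.div_ofReal_im]

theorem normAut_I (p : ℂ) : normAut p Complex.I = p := Complex.re_add_im p

theorem normAut_normAutInv {p : ℂ} (hp : 0 < p.im) (z : ℂ) : normAut p (normAutInv p z) = z := by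
  have : (p.im : ℂ) ≠ 0 := by exact_mod_cast hp.ne'
  rw [normAut, normAutInv]
  field_simp
  ring

theorem normAutInv_eq {p : ℂ} (hp : 0 < p.im) (z : ℂ) :
    normAutInv p z = Complex.I + (z - p) / (p.im : ℂ) := by
  have : (p.im : ℂ) ≠ 0 := by exact_mod_cast hp.ne'
  rw [normAutInv]
  field_simp
  linear_combination -Complex.re_add_im p

theorem normAut_eq (p z : ℂ) : normAut p z = p + p.im * (z - Complex.I) := by
  rw [normAut]
  linear_combination Complex.re_add_im p

theorem differentiable_normAut (p : ℂ) : Differentiable ℂ (normAut p) := by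
  unfold normAut; fun_prop

theorem differentiable_normAutInv (p : ℂ) : Differentiable ℂ (normAutInv p) := by
  unfold normAutInv; fun_prop

/-- The normalized iterates of `f` along the backward orbit `w`. -/
noncomputable def normIter (f : ℂ → ℂ) (w : ℕ → ℂ) (n : ℕ) (z : ℂ) : ℂ :=
  f^[n] (normAut (w n) z)

/-- The map with `normIter f w m = normIter f w n ∘ transition f w n m` for `n ≤ m`. -/
noncomputable def transition (f : ℂ → ℂ) (w : ℕ → ℂ) (n m : ℕ) (z : ℂ) : ℂ :=
  normAutInv (w n) (f^[m - n] (normAut (w m) z))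

namespace IsBackwardOrbit

variable {f : ℂ → ℂ} {w : ℕ → ℂ} {b : ℝ}

theorem normAut_im_pos (h : IsBackwardOrbit f w) (n : ℕ) {z : ℂ} (hz : 0 < z.im) :
    0 < (normAut (w n) z).im := by
  rw [normAut_im]; exact mul_pos (h.pos n) hz

theorem normAutInv_succ (h : IsBackwardOrbit f w) (n : ℕ) :
    normAutInv (w n) (w (n + 1)) = Complex.I + stepVec w n :=
  normAutInv_eq (h.pos n) _

theorem normIter_differentiableOn (h : IsBackwardOrbit f w) (n : ℕ) :
    DifferentiableOn ℂ (normIter f w n) {z | 0 < z.im} :=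
  (h.inc.iterate n).diff.comp (differentiable_normAut _).differentiableOn
    fun _ hz => h.normAut_im_pos n hz

theorem normIter_im_pos (h : IsBackwardOrbit f w) (n : ℕ) (z : ℂ) (hz : 0 < z.im) :
    0 < (normIter f w n z).im :=
  (h.inc.iterate n).pos _ (h.normAut_im_pos n hz)

theorem normIter_I (h : IsBackwardOrbit f w) (n : ℕ) : normIter f w n Complex.I = w 0 := by
  rw [normIter, normAut_I]
  simpa using h.iterate_map n 0

theorem transition_differentiableOn (h : IsBackwardOrbit f w) (n m : ℕ) :
    DifferentiableOn ℂ (transition f w n m) {z | 0 < z.im} :=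
  (differentiable_normAutInv _).comp_differentiableOn
    ((h.inc.iterate (m - n)).diff.comp (differentiable_normAut _).differentiableOn
      fun _ hz => h.normAut_im_pos m hz)

theorem transition_im_pos (h : IsBackwardOrbit f w) (n m : ℕ) (z : ℂ) (hz : 0 < z.im) :
    0 < (transition f w n m z).im := by
  rw [transition, normAutInv_im]
  exact div_pos ((h.inc.iterate (m - n)).pos _ (h.normAut_im_pos m hz)) (h.pos n)

theorem transition_I (h : IsBackwardOrbit f w) {n m : ℕ} (hnm : n ≤ m) :
    transition f w n m Complex.I = Complex.I := by
  rw [transition, normAut_I, h.iterate_map_sub hnm, normAutInv_eq (h.pos n), sub_self, zero_div,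
    add_zero]

theorem transition_step (h : IsBackwardOrbit f w) {n m : ℕ} (hnm : n ≤ m) :
    transition f w n m (Complex.I + stepVec w m) = Complex.I + stepVec w n := by
  have e1 : f^[m - n] (w (m + 1)) = w (n + 1) := by
    have := h.iterate_map_sub (Nat.succ_le_succ hnm)
    rwa [Nat.succ_sub_succ] at this
  rw [transition, ← h.normAutInv_succ m, normAut_normAutInv (h.pos m), e1, h.normAutInv_succ]

theorem normIter_eq_comp (h : IsBackwardOrbit f w) {n m : ℕ} (hnm : n ≤ m) (z : ℂ) :
    normIter f w m z = normIter f w n (transition f w n m z) := by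
  rw [normIter, normIter, transition, normAut_normAutInv (h.pos n), ← Function.iterate_add_apply,
    Nat.add_sub_cancel' hnm]

theorem exists_forall_norm_normIter_sub_lt (h : IsBackwardOrbit f w)
    (hv : Tendsto (stepVec w) atTop (𝓝 (b : ℂ))) (hb : b ≠ 0) {R δ ε : ℝ}
    (hR : 0 < R) (hδ : 0 < δ) (hε : 0 < ε) :
    ∃ N, ∀ n m, N ≤ n → n ≤ m → ∀ z : ℂ, ‖z‖ ≤ R → δ ≤ z.im →
      ‖normIter f w m z - normIter f w n z‖ < ε := by
  have hσ : 0 < (Complex.I + b).im := by simp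
  have hσI : Complex.I + b ≠ Complex.I := by simpa using hb
  -- Common Lipschitz constant on the region ‖z‖ ≤ R + 1, δ/2 ≤ Im z, which has room for the
  -- transition image of `z`.
  set L := ‖w 0‖ * ((R + 1 + 1) ^ 2 / (δ / 2) + 2) / (δ / 2) with hL
  have hL0 : 0 ≤ L := by positivity
  obtain ⟨ρ, hρ, H⟩ := exists_forall_norm_map_sub_lt hσ hσI hR hδ
    (ε := min (min 1 (δ / 2)) (ε / (L + 1))) (by positivity)
  have hI : Tendsto (fun n => Complex.I + stepVec w n) atTop (𝓝 (Complex.I + b)) :=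
    hv.const_add _
  obtain ⟨N, hN⟩ := (Metric.tendsto_atTop.mp hI) ρ hρ
  refine ⟨N, fun n m hn hnm z hz hzδ => ?_⟩
  have hG := H (transition f w n m) (Complex.I + stepVec w m) (h.transition_differentiableOn n m)
    (h.transition_im_pos n m) (h.transition_I hnm) (hN m (hn.trans hnm))
    (by rw [h.transition_step hnm]; exact hN n hn) z hz hzδ
  have g1 := hG.trans_le ((min_le_left _ _).trans (min_le_left _ _))
  have g2 := hG.trans_le ((min_le_left _ _).trans (min_le_right _ _))
  have g3 := hG.trans_le (min_le_right _ _)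
  rw [h.normIter_eq_comp hnm]
  have hz1 : ‖transition f w n m z‖ ≤ R + 1 := by
    have : transition f w n m z = (transition f w n m z - z) + z := by ring
    rw [this]
    refine (norm_add_le _ _).trans ?_
    linarith
  have hz2 : δ / 2 ≤ (transition f w n m z).im := by
    have := (Complex.abs_im_le_norm (transition f w n m z - z)).trans g2.le
    rw [Complex.sub_im] at this
    linarith [(abs_le.mp this).1]
  have key := norm_map_sub_le (h.normIter_differentiableOn n)
    (fun z hz => (h.normIter_im_pos n z hz).le) (half_pos hδ) hz1 hz2
    (z' := z) (by linarith) (by linarith)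
  rw [h.normIter_I, ← hL] at key
  rw [lt_div_iff₀ (by positivity)] at g3
  nlinarith [norm_nonneg (transition f w n m z - z)]

theorem uniformCauchySeqOn_normIter (h : IsBackwardOrbit f w)
    (hv : Tendsto (stepVec w) atTop (𝓝 (b : ℂ))) (hb : b ≠ 0) {K : Set ℂ}
    (hKH : K ⊆ {z | 0 < z.im}) (hK : IsCompact K) :
    UniformCauchySeqOn (normIter f w) atTop K := by
  obtain ⟨R, hR, δ, hδ, hKb⟩ := hK.exists_norm_le_and_le_im hKH
  rw [Metric.uniformCauchySeqOn_iff]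
  intro ε hε
  obtain ⟨N, hN⟩ := h.exists_forall_norm_normIter_sub_lt hv hb hR hδ hε
  refine ⟨N, fun m hm n hn z hz => ?_⟩
  rw [dist_eq_norm]
  rcases le_total n m with hnm | hnm
  · exact hN n m hn hnm z (hKb z hz).1 (hKb z hz).2
  · rw [norm_sub_rev]
    exact hN m n hm hnm z (hKb z hz).1 (hKb z hz).2

theorem exists_tendsto_normIter (h : IsBackwardOrbit f w)
    (hv : Tendsto (stepVec w) atTop (𝓝 (b : ℂ))) (hb : b ≠ 0) :
    ∃ ψ : ℂ → ℂ, TendstoUniformlyOnCompactsHP (normIter f w) ψ := by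
  refine ⟨fun z => limUnder atTop fun n => normIter f w n z, fun K hKH hK => ?_⟩
  have hc := h.uniformCauchySeqOn_normIter hv hb hKH hK
  exact hc.tendstoUniformlyOn_of_tendsto fun z hz => (hc.cauchySeq hz).tendsto_limUnder

end IsBackwardOrbit

theorem TendstoUniformlyOnCompactsHP.tendstoLocallyUniformlyOn {F : ℕ → ℂ → ℂ} {ψ : ℂ → ℂ}
    (hψ : TendstoUniformlyOnCompactsHP F ψ) :
    TendstoLocallyUniformlyOn F ψ atTop {z | 0 < z.im} :=
  (tendstoLocallyUniformlyOn_iff_forall_isCompact isOpen_im_pos).mpr hψ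

namespace IsBackwardOrbit

variable {f : ℂ → ℂ} {w : ℕ → ℂ} {b : ℝ} {ψ : ℂ → ℂ}

theorem tendsto_heightRatio_of_stepVec (h : IsBackwardOrbit f w)
    (hv : Tendsto (stepVec w) atTop (𝓝 (b : ℂ))) : Tendsto (heightRatio w) atTop (𝓝 1) := by
  have := ((Complex.continuous_im.tendsto _).comp hv).const_add 1
  rw [Complex.ofReal_im, add_zero] at this
  exact this.congr fun n => (h.heightRatio_eq n).symm

theorem limit_differentiableOn (h : IsBackwardOrbit f w)
    (hψ : TendstoUniformlyOnCompactsHP (normIter f w) ψ) :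
    DifferentiableOn ℂ ψ {z | 0 < z.im} :=
  hψ.tendstoLocallyUniformlyOn.differentiableOn
    (Eventually.of_forall h.normIter_differentiableOn) isOpen_im_pos

theorem tendsto_normIter_along (h : IsBackwardOrbit f w)
    (hψ : TendstoUniformlyOnCompactsHP (normIter f w) ψ) {z : ℂ} (hz : 0 < z.im) {ζ : ℕ → ℂ}
    (hζ : Tendsto ζ atTop (𝓝 z)) : Tendsto (fun n => normIter f w n (ζ n)) atTop (𝓝 (ψ z)) := by
  refine hψ.tendstoLocallyUniformlyOn.tendsto_comp
    ((h.limit_differentiableOn hψ).continuousOn z hz) hz ?_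
  exact tendsto_nhdsWithin_iff.mpr ⟨hζ, hζ (isOpen_im_pos.mem_nhds hz)⟩

theorem limit_I (h : IsBackwardOrbit f w) (hψ : TendstoUniformlyOnCompactsHP (normIter f w) ψ) :
    ψ Complex.I = w 0 := by
  have h1 := h.tendsto_normIter_along hψ (z := Complex.I) (by simp) tendsto_const_nhds
  simp only [h.normIter_I] at h1
  exact tendsto_nhds_unique h1 tendsto_const_nhds

/-- A real value at `z` would, by Schwarz–Pick with `I`, equal ψ(I) = `w 0`, which is not real. -/
theorem limit_im_pos (h : IsBackwardOrbit f w)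
    (hψ : TendstoUniformlyOnCompactsHP (normIter f w) ψ) (z : ℂ) (hz : 0 < z.im) :
    0 < (ψ z).im := by
  have hnn : ∀ z : ℂ, 0 < z.im → 0 ≤ (ψ z).im := fun z hz =>
    ge_of_tendsto ((Complex.continuous_im.tendsto _).comp
      (h.tendsto_normIter_along hψ hz tendsto_const_nhds))
      (Eventually.of_forall fun n => (h.normIter_im_pos n z hz).le)
  refine lt_of_le_of_ne (hnn z hz) fun h0 => ?_
  have hI : 0 < Complex.I.im := by simp
  have key := schwarzPick (h.limit_differentiableOn hψ) hnn hz hI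
  rw [← h0, zero_mul, zero_mul, h.limit_I hψ] at key
  have h1 : ‖ψ z - w 0‖ ^ 2 ≤ 0 := nonpos_of_mul_nonpos_left key (mul_pos hz hI)
  have h2 : ψ z - w 0 = 0 := by
    rw [← norm_eq_zero]
    exact pow_eq_zero_iff two_ne_zero |>.mp (le_antisymm h1 (sq_nonneg _))
  have h3 := h.pos 0
  rw [← sub_eq_zero.mp h2, ← h0] at h3
  exact lt_irrefl _ h3

/-- Pass to the limit in f ∘ f^[n] ∘ τ_n = (f^[n+1] ∘ τ_{n+1}) ∘ (τ_{n+1}⁻¹ ∘ τ_n), whose last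
factor tends to z ↦ z - b. -/
theorem limit_sub (h : IsBackwardOrbit f w) (hv : Tendsto (stepVec w) atTop (𝓝 (b : ℂ)))
    (hψ : TendstoUniformlyOnCompactsHP (normIter f w) ψ) {z : ℂ} (hz : 0 < z.im) :
    ψ (z - b) = f (ψ z) := by
  have hc := (h.tendsto_heightRatio_of_stepVec hv).inv₀ one_ne_zero
  rw [inv_one] at hc
  have hfc : ContinuousAt f (ψ z) :=
    (h.inc.diff.differentiableAt (isOpen_im_pos.mem_nhds (h.limit_im_pos hψ z hz))).continuousAt
  have h1 : Tendsto (fun n => f (normIter f w n z)) atTop (𝓝 (f (ψ z))) :=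
    hfc.tendsto.comp (h.tendsto_normIter_along hψ hz tendsto_const_nhds)
  have hζ' : Tendsto (fun n => Complex.I + ((heightRatio w n)⁻¹ : ℝ) * (z - Complex.I - stepVec w n))
      atTop (𝓝 (Complex.I + (1 : ℝ) * (z - Complex.I - b))) :=
    (((Complex.continuous_ofReal.tendsto _).comp hc).mul (hv.const_sub _)).const_add _
  have hζ : Tendsto (fun n => normAutInv (w (n + 1)) (normAut (w n) z)) atTop (𝓝 (z - b)) := by
    have e : Complex.I + (1 : ℝ) * (z - Complex.I - b) = z - b := by push_cast; ring
    rw [e] at hζ'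
    refine hζ'.congr fun n => ?_
    have h1 := h.im_ne_zero n
    have h2 := h.im_ne_zero (n + 1)
    rw [normAutInv_eq (h.pos _), normAut_eq, heightRatio]
    push_cast
    field_simp
    linear_combination h.succ_eq n
  have h2 : Tendsto (fun n => normIter f w n (normAutInv (w n) (normAut (w (n - 1)) z))) atTop
      (𝓝 (ψ (z - b))) := by
    refine h.tendsto_normIter_along hψ (by simpa using hz) ?_
    rw [← tendsto_add_atTop_iff_nat 1]
    simpa using hζ
  rw [← tendsto_add_atTop_iff_nat 1] at h2
  refine tendsto_nhds_unique h2 (h1.congr fun n => ?_)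
  rw [Nat.add_sub_cancel, normIter, normIter, normAut_normAutInv (h.pos _),
    Function.iterate_succ_apply']

theorem tendsto_im_add_div (h : IsBackwardOrbit f w)
    (hc : Tendsto (heightRatio w) atTop (𝓝 1)) (k : ℕ) :
    Tendsto (fun n => (w (n + k)).im / (w n).im) atTop (𝓝 1) := by
  induction k with
  | zero =>
    refine tendsto_const_nhds.congr fun n => ?_
    exact (div_self (h.pos n).ne').symm
  | succ k ih =>
    have := ih.mul ((tendsto_add_atTop_iff_nat k).mpr hc)
    rw [one_mul] at this
    refine this.congr fun n => ?_
    rw [← add_assoc, h.im_succ (n + k)]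
    ring

theorem tendsto_normAutInv_add (h : IsBackwardOrbit f w)
    (hv : Tendsto (stepVec w) atTop (𝓝 (b : ℂ))) (k : ℕ) :
    Tendsto (fun n => normAutInv (w n) (w (n + k))) atTop (𝓝 (Complex.I + k * b)) := by
  induction k with
  | zero =>
    simp only [add_zero, Nat.cast_zero, zero_mul]
    refine tendsto_const_nhds.congr fun n => ?_
    rw [normAutInv_eq (h.pos n), sub_self, zero_div, add_zero]
  | succ k ih =>
    have h1 := h.tendsto_im_add_div (h.tendsto_heightRatio_of_stepVec hv) k
    have h2 := ih.add (((Complex.continuous_ofReal.tendsto _).comp h1).mul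
      ((tendsto_add_atTop_iff_nat k).mpr hv))
    have e : Complex.I + k * b + (1 : ℝ) * b = Complex.I + (k + 1 : ℕ) * b := by
      push_cast; ring
    rw [e] at h2
    refine h2.congr fun n => ?_
    have h3 := h.im_ne_zero n
    rw [normAutInv_eq (h.pos n), normAutInv_eq (h.pos n), ← add_assoc, h.succ_eq (n + k),
      Function.comp_apply]
    push_cast
    field_simp
    ring

theorem limit_add_nat_mul (h : IsBackwardOrbit f w) (hv : Tendsto (stepVec w) atTop (𝓝 (b : ℂ)))
    (hψ : TendstoUniformlyOnCompactsHP (normIter f w) ψ) (k : ℕ) :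
    ψ (Complex.I + k * b) = w k := by
  have h1 := h.tendsto_normIter_along hψ (z := Complex.I + k * b) (by simp)
    (h.tendsto_normAutInv_add hv k)
  refine tendsto_nhds_unique h1 (tendsto_const_nhds.congr fun n => ?_)
  rw [normIter, normAut_normAutInv (h.pos n), add_comm, h.iterate_map]

/-- The renormalizations of `ψ` at the points `I + n b` tend to the identity. -/
theorem tendsto_renormalization (h : IsBackwardOrbit f w)
    (hv : Tendsto (stepVec w) atTop (𝓝 (b : ℂ))) (hb : b ≠ 0)
    (hψ : TendstoUniformlyOnCompactsHP (normIter f w) ψ) :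
    TendstoUniformlyOnCompactsHP (fun n z => normAutInv (w n) (ψ (z + n * b))) id := by
  intro K hKH hK
  obtain ⟨R, hR, δ, hδ, hKb⟩ := hK.exists_norm_le_and_le_im hKH
  rw [Metric.tendstoUniformlyOn_iff]
  intro ε hε
  have hσ : 0 < (Complex.I + b).im := by simp
  have hσI : Complex.I + b ≠ Complex.I := by simpa using hb
  obtain ⟨ρ, hρ, H⟩ := exists_forall_norm_map_sub_lt hσ hσI hR hδ hε
  have hI : Tendsto (fun n => Complex.I + stepVec w n) atTop (𝓝 (Complex.I + b)) :=
    hv.const_add _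
  filter_upwards [hI.eventually (Metric.ball_mem_nhds _ hρ)] with n hn z hz
  have hmaps : ∀ z : ℂ, 0 < z.im → 0 < (z + n * b).im := fun z hz => by simpa using hz
  rw [dist_comm, dist_eq_norm]
  refine H (fun z => normAutInv (w n) (ψ (z + n * b))) (Complex.I + b) ?_ ?_ ?_ (by simpa) ?_
    z (hKb z hz).1 (hKb z hz).2
  · exact (differentiable_normAutInv _).comp_differentiableOn
      ((h.limit_differentiableOn hψ).comp (differentiableOn_id.add_const _) hmaps)
  · intro z hz
    rw [normAutInv_im]
    exact div_pos (h.limit_im_pos hψ _ (hmaps z hz)) (h.pos n)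
  · rw [h.limit_add_nat_mul hv hψ, normAutInv_eq (h.pos n), sub_self, zero_div, add_zero]
  · have e : Complex.I + b + n * b = Complex.I + (n + 1 : ℕ) * b := by push_cast; ring
    rw [e, h.limit_add_nat_mul hv hψ, h.normAutInv_succ]
    exact hn

/-- Each quotient is the derivative at `I` of a renormalization of ψ, and these tend to the
identity. -/
theorem tendsto_deriv_limit (h : IsBackwardOrbit f w)
    (hv : Tendsto (stepVec w) atTop (𝓝 (b : ℂ))) (hb : b ≠ 0)
    (hψ : TendstoUniformlyOnCompactsHP (normIter f w) ψ) :
    Tendsto (fun n : ℕ => deriv ψ (Complex.I + n * b) / ((w n).im : ℂ)) atTop (𝓝 1) := by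
  have hmaps : ∀ (n : ℕ) (z : ℂ), 0 < z.im → 0 < (z + n * b).im := fun n z hz => by simpa using hz
  have h1 := (h.tendsto_renormalization hv hb hψ).tendstoLocallyUniformlyOn.deriv
    (Eventually.of_forall fun n => (differentiable_normAutInv _).comp_differentiableOn
      ((h.limit_differentiableOn hψ).comp (differentiableOn_id.add_const _) (hmaps n)))
    isOpen_im_pos
  have h2 := h1.tendsto_at (a := Complex.I) (by simp)
  rw [deriv_id] at h2
  refine h2.congr fun n => ?_
  simp only [Function.comp_apply, normAutInv]
  rw [deriv_div_const, deriv_sub_const, deriv_comp_add_const]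

/-- Reduce x modulo `b`: on the segment above [kb, (k+1)b], ψ stays within y_0 (b + 1) of `w k` once
k is large, by uniform convergence of the renormalizations. -/
theorem tendsto_limit_line (h : IsBackwardOrbit f w)
    (hv : Tendsto (stepVec w) atTop (𝓝 (b : ℂ))) (hb : 0 < b)
    (hψ : TendstoUniformlyOnCompactsHP (normIter f w) ψ)
    (hinf : Tendsto w atTop (Bornology.cobounded ℂ)) :
    Tendsto (fun x : ℝ => ψ (x + Complex.I)) atTop (Bornology.cobounded ℂ) := by
  rw [← tendsto_norm_atTop_iff_cobounded, tendsto_atTop]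
  intro M
  set K : Set ℂ := (fun t : ℝ => (t : ℂ) + Complex.I) '' Icc 0 b with hK
  have hKc : IsCompact K := isCompact_Icc.image (by fun_prop)
  have hKH : K ⊆ UpperHalfPlane.upperHalfPlaneSet := by
    rintro _ ⟨t, _, rfl⟩
    simp [UpperHalfPlane.upperHalfPlaneSet]
  have h1 := Metric.tendstoUniformlyOn_iff.mp (h.tendsto_renormalization hv hb.ne' hψ K hKH hKc) 1
    one_pos
  have h2 := (tendsto_norm_atTop_iff_cobounded.mpr hinf).eventually_ge_atTop
    (M + (w 0).im * (b + 1))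
  have hfl : Tendsto (fun x : ℝ => ⌊x / b⌋₊) atTop atTop :=
    tendsto_nat_floor_atTop.comp (tendsto_id.atTop_div_const hb)
  filter_upwards [hfl.eventually (h1.and h2), eventually_ge_atTop 0] with x hx hx0
  obtain ⟨hx1, hx2⟩ := hx
  set k := ⌊x / b⌋₊ with hk
  set t := x - k * b with ht
  have ht0 : 0 ≤ t := by
    have := Nat.floor_le (div_nonneg hx0 hb.le)
    rw [le_div_iff₀ hb] at this
    linarith
  have htb : t ≤ b := by
    have := Nat.lt_floor_add_one (x / b)
    rw [div_lt_iff₀ hb] at this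
    linarith
  have h3 := hx1 (t + Complex.I) ⟨t, ⟨ht0, htb⟩, rfl⟩
  have e1 : (t : ℂ) + Complex.I + k * b = x + Complex.I := by rw [ht]; push_cast; ring
  rw [e1, dist_comm, dist_eq_norm, id] at h3
  set u := normAutInv (w k) (ψ (x + Complex.I)) with hu
  have e2 : ψ (x + Complex.I) = w k + (w k).im * (u - Complex.I) := by
    rw [← normAut_eq, hu, normAut_normAutInv (h.pos k)]
  have h4 : ‖u - Complex.I‖ ≤ b + 1 := by
    have e3 : u - Complex.I = (u - (t + Complex.I)) + t := by ring
    rw [e3]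
    refine (norm_add_le _ _).trans ?_
    rw [Complex.norm_real, Real.norm_eq_abs, abs_of_nonneg ht0]
    linarith
  have h5 : ‖(w k).im * (u - Complex.I)‖ ≤ (w 0).im * (b + 1) := by
    rw [norm_mul, Complex.norm_real, Real.norm_eq_abs, abs_of_pos (h.pos k)]
    exact mul_le_mul (h.im_antitone (Nat.zero_le k)) h4 (norm_nonneg _) (h.pos 0).le
  rw [e2]
  have h6 : ‖w k‖ - ‖(w k).im * (u - Complex.I)‖ ≤ ‖w k + (w k).im * (u - Complex.I)‖ := by
    have := norm_sub_norm_le (w k) (-((w k).im * (u - Complex.I)))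
    rwa [norm_neg, sub_neg_eq_add] at this
  linarith

end IsBackwardOrbit

/-! ### From a ray to sectors: a Lindelöf theorem. -/

/-- The two-constants theorem for the half-plane `{z | 1 ≤ z.im}`, in the coordinate
`ζ = log (z - R - I)`. -/
theorem norm_le_exp_of_norm_le_on_ray {F : ℂ → ℂ} (hd : DifferentiableOn ℂ F {z | 0 < z.im})
    (hF : ∀ z : ℂ, 0 < z.im → ‖F z‖ ≤ 1) {R L : ℝ} (hL : 0 ≤ L)
    (hR : ∀ x : ℝ, R ≤ x → ‖F (x + Complex.I)‖ ≤ Real.exp (-L)) {ζ : ℂ} (h0 : 0 ≤ ζ.im)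
    (hπ : ζ.im ≤ Real.pi) :
    ‖F (R + Complex.I + Complex.exp ζ)‖ ≤ Real.exp (-(L * (1 - ζ.im / Real.pi))) := by
  have hπ0 := Real.pi_pos
  -- The exponential factor has modulus exp(L(1 - Im ζ/π)): it offsets the bound exp(-L) on the edge
  -- Im ζ = 0 and is unimodular on the edge Im ζ = π.
  set g : ℂ → ℂ := fun ζ => F (R + Complex.I + Complex.exp ζ) *
    Complex.exp (L * (1 + Complex.I * ζ / Real.pi)) with hg
  have hre : ∀ ζ : ℂ, ((L : ℂ) * (1 + Complex.I * ζ / Real.pi)).re = L * (1 - ζ.im / Real.pi) := by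
    intro ζ
    rw [Complex.re_ofReal_mul, Complex.add_re, Complex.div_ofReal_re]
    simp [sub_eq_add_neg, neg_div]
  have hgn : ∀ ζ, ‖g ζ‖ = ‖F (R + Complex.I + Complex.exp ζ)‖ *
      Real.exp (L * (1 - ζ.im / Real.pi)) := by
    intro ζ
    rw [hg, norm_mul, Complex.norm_exp, hre]
  have hmem : ∀ ζ : ℂ, 0 ≤ ζ.im → ζ.im ≤ Real.pi →
      0 < (R + Complex.I + Complex.exp ζ).im := by
    intro ζ h0 hπ
    rw [Complex.add_im, Complex.exp_im]
    have := Real.sin_nonneg_of_nonneg_of_le_pi h0 hπ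
    have : 0 ≤ Real.exp ζ.re * Real.sin ζ.im := by positivity
    simp
    linarith
  have hcl : closure (Complex.im ⁻¹' Ioo 0 Real.pi) ⊆ Complex.im ⁻¹' Icc 0 Real.pi :=
    closure_minimal (preimage_mono Ioo_subset_Icc_self)
      (isClosed_Icc.preimage Complex.continuous_im)
  have hgd : DiffContOnCl ℂ g (Complex.im ⁻¹' Ioo 0 Real.pi) := by
    refine DifferentiableOn.diffContOnCl (DifferentiableOn.mono ?_ hcl)
    refine DifferentiableOn.mul (hd.comp (by fun_prop) fun ζ hζ => hmem ζ hζ.1 hζ.2) ?_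
    fun_prop
  have hB : ∃ c < Real.pi / (Real.pi - 0), ∃ B,
      g =O[comap (_root_.abs ∘ Complex.re) atTop ⊓ 𝓟 (Complex.im ⁻¹' Ioo 0 Real.pi)]
        fun z ↦ Real.exp (B * Real.exp (c * |z.re|)) := by
    refine ⟨0, by rw [sub_zero]; positivity, 0, ?_⟩
    refine Asymptotics.IsBigO.of_bound (Real.exp L) (mem_inf_of_right ?_)
    rw [mem_principal]
    intro ζ hζ
    have h1 := hF _ (hmem ζ hζ.1.le hζ.2.le)
    simp only [zero_mul, Real.exp_zero, norm_one, mul_one, mem_ofPred_eq]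
    rw [hgn]
    have h2 : 0 ≤ ζ.im / Real.pi := div_nonneg hζ.1.le hπ0.le
    calc _ ≤ 1 * Real.exp L := by gcongr; nlinarith
      _ = _ := one_mul _
  have key : ‖g ζ‖ ≤ 1 := by
    refine PhragmenLindelof.horizontal_strip hgd hB ?_ ?_ h0 hπ
    · intro z hz
      have hz' : (R : ℂ) + Complex.I + Complex.exp z = (R + Real.exp z.re : ℝ) + Complex.I := by
        rw [← Complex.re_add_im z, hz]
        push_cast
        simp
        ring
      rw [hgn, hz, zero_div, sub_zero, mul_one, hz']
      calc _ ≤ Real.exp (-L) * Real.exp L := by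
            gcongr
            exact hR _ (by linarith [Real.exp_pos z.re])
        _ = 1 := by rw [← Real.exp_add]; simp
    · intro z hz
      rw [hgn, hz, div_self hπ0.ne', sub_self, mul_zero, Real.exp_zero, mul_one]
      exact hF _ (hmem z (hz ▸ hπ0.le) hz.le)
  rw [hgn] at key
  rw [Real.exp_neg, ← one_div, le_div_iff₀ (Real.exp_pos _)]
  exact key

theorem norm_mul_cos_le_im {θ : ℝ} (hθ : θ < Real.pi / 2) {z : ℂ} (hz : z ∈ sectorAtInfty θ) :
    ‖z‖ * Real.cos θ ≤ z.im := by
  have h1 : z.im = ‖z‖ * Real.cos |z.arg - Real.pi / 2| := by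
    rw [Real.cos_abs, Real.cos_sub_pi_div_two, Complex.norm_mul_sin_arg]
  rw [h1]
  have h2 := hz.2.le
  gcongr
  exact Real.cos_le_cos_of_nonneg_of_le_pi (abs_nonneg _) (by linarith [Real.pi_pos]) h2

theorem div_norm_le_pi_sub_arg (z : ℂ) : z.im / ‖z‖ ≤ Real.pi - z.arg := by
  have h1 := Real.sin_le (sub_nonneg.mpr (Complex.arg_le_pi z))
  rwa [Real.sin_pi_sub, Complex.sin_arg] at h1

/-- A Lindelöf theorem: an analytic self-map of the upper half-plane that tends to infinity along a
horizontal ray has the non-tangential limit infinity. -/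
theorem IsAnalyticSelfMap.nTTendstoAtInfty {ψ : ℂ → ℂ} (hψ : IsAnalyticSelfMap ψ)
    (hray : Tendsto (fun x : ℝ => ψ (x + Complex.I)) atTop (Bornology.cobounded ℂ)) :
    NTTendstoAtInfty ψ (Bornology.cobounded ℂ) := by
  intro θ hθ0 hθ
  have hπ0 := Real.pi_pos
  have hpos : ∀ z : ℂ, 0 < z.im → 0 < (ψ z).im := fun z hz => hψ.mapsTo hz
  have hd : DifferentiableOn ℂ (fun z => (ψ z + Complex.I)⁻¹) {z | 0 < z.im} :=
    (hψ.differentiableOn.add_const _).inv fun z hz => add_I_ne_zero (hpos z hz)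
  have hF : ∀ z : ℂ, 0 < z.im → ‖(ψ z + Complex.I)⁻¹‖ ≤ 1 := by
    intro z hz
    rw [norm_inv]
    refine inv_le_one_of_one_le₀ ?_
    have h1 := Complex.im_le_norm (ψ z + Complex.I)
    rw [Complex.add_im, Complex.I_im] at h1
    linarith [hpos z hz]
  rw [← tendsto_norm_atTop_iff_cobounded, tendsto_atTop]
  intro M
  have hcos : 0 < Real.cos θ := Real.cos_pos_of_mem_Ioo ⟨by linarith, hθ⟩
  -- Lower bound on the sector for 1 - arg u/π, the harmonic measure of the ray. One factor 1/2
  -- comes from Im u ≥ Im z/2, the other from ‖u‖ ≤ 2‖z‖. `L` is then chosen so that `L * κ = |M| +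
  -- 1`.
  set κ := Real.cos θ / 4 / Real.pi with hκ
  have hκ0 : 0 < κ := by positivity
  set L := (|M| + 1) / κ with hL
  have hL0 : 0 ≤ L := by positivity
  have hev := (tendsto_norm_atTop_iff_cobounded.mpr hray).eventually_ge_atTop (Real.exp L + 1)
  obtain ⟨R₀, hR₀⟩ := eventually_atTop.mp hev
  set R := max R₀ 0 with hR
  have hRF : ∀ x : ℝ, R ≤ x → ‖(ψ (x + Complex.I) + Complex.I)⁻¹‖ ≤ Real.exp (-L) := by
    intro x hx
    rw [norm_inv, Real.exp_neg]
    refine inv_anti₀ (Real.exp_pos _) ?_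
    have h1 := hR₀ x ((le_max_left _ _).trans hx)
    have h2 := norm_sub_norm_le (ψ (x + Complex.I)) (-Complex.I)
    rw [norm_neg, Complex.norm_I, sub_neg_eq_add] at h2
    linarith
  have hR0 : 0 ≤ R := le_max_right _ _
  have hlarge : ∀ᶠ z in Bornology.cobounded ℂ ⊓ 𝓟 (sectorAtInfty θ),
      max (R + 1) (2 / Real.cos θ) ≤ ‖z‖ :=
    (tendsto_norm_cobounded_atTop.mono_left inf_le_left).eventually_ge_atTop _
  have hsec : ∀ᶠ z in Bornology.cobounded ℂ ⊓ 𝓟 (sectorAtInfty θ), z ∈ sectorAtInfty θ :=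
    mem_inf_of_right (mem_principal_self _)
  filter_upwards [hlarge, hsec] with z hz hzs
  have hz1 := (le_max_left _ _).trans hz
  have hz2 := (le_max_right _ _).trans hz
  rw [div_le_iff₀ hcos] at hz2
  have him := norm_mul_cos_le_im hθ hzs
  set u := z - R - Complex.I with hu
  have hui : u.im = z.im - 1 := by simp [hu]
  have hu0 : 0 < u.im := by linarith
  have hune : u ≠ 0 := by
    intro h; rw [h] at hu0; simp at hu0
  have hun : ‖u‖ ≤ 2 * ‖z‖ := by
    have h1 : ‖u‖ ≤ ‖z‖ + ‖(R : ℂ)‖ + ‖Complex.I‖ :=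
      (norm_sub_le _ _).trans (add_le_add_left (norm_sub_le _ _) _)
    rw [Complex.norm_I, Complex.norm_real, Real.norm_eq_abs, abs_of_nonneg hR0] at h1
    linarith
  have hu4 : Real.cos θ / 4 ≤ u.im / ‖u‖ := by
    rw [le_div_iff₀ (norm_pos_iff.mpr hune)]
    nlinarith
  have harg := hu4.trans (div_norm_le_pi_sub_arg u)
  have hκarg : κ ≤ 1 - u.arg / Real.pi := by
    rw [hκ, div_le_iff₀ hπ0, sub_mul, div_mul_cancel₀ _ hπ0.ne']
    linarith
  have key := norm_le_exp_of_norm_le_on_ray hd hF hL0 hRF (ζ := Complex.log u)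
    (by rw [Complex.log_im]; exact Complex.arg_nonneg_iff.mpr hu0.le)
    (by rw [Complex.log_im]; exact Complex.arg_le_pi u)
  rw [Complex.exp_log hune, Complex.log_im] at key
  have e1 : (R : ℂ) + Complex.I + u = z := by rw [hu]; ring
  rw [e1, norm_inv, Real.exp_neg] at key
  have h5 := hpos z hzs.1
  have h6 := (inv_le_inv₀ (norm_pos_iff.mpr (add_I_ne_zero h5)) (Real.exp_pos _)).mp key
  have h7 : |M| + 1 ≤ L * (1 - u.arg / Real.pi) := by
    calc |M| + 1 = L * κ := by rw [hL, div_mul_cancel₀ _ hκ0.ne']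
      _ ≤ _ := by gcongr
  have h8 := Real.add_one_le_exp (L * (1 - u.arg / Real.pi))
  have h9 := norm_add_le (ψ z) Complex.I
  rw [Complex.norm_I] at h9
  linarith [le_abs_self M]

theorem corollary1p11 (φ : ℂ → ℂ) (hφ : IsParabolicSelfMap φ)
    (w : ℕ → ℂ) (hw : IsBackwardIteration φ w)
    (a : ℝ) (ha : a < 1)
    (hstep : Tendsto (fun n => pseudoHypDist (w n) (w (n + 1))) atTop (𝓝 a))
    (hinf : Tendsto w atTop (Bornology.cobounded ℂ))
    (harg : Tendsto (fun n => (w n).arg) atTop (𝓝 0)) :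
    Tendsto (fun n => ((w (n + 1)).re - (w n).re) / (w n).im) atTop
      (𝓝 (stepTranslation a)) ∧
    (∃ ψ : ℂ → ℂ,
      -- the conjugation: the limit of the normalized iterates
      TendstoUniformlyOnCompactsHP (fun n z => φ^[n] (normAut (w n) z)) ψ ∧
      IsAnalyticSelfMap ψ ∧
      (∀ z ∈ UpperHalfPlane.upperHalfPlaneSet, ψ (z - (stepTranslation a : ℂ)) = φ (ψ z)) ∧
      -- its values and derivatives along `i + n b₀`
      (∀ n : ℕ, ψ (Complex.I + (n : ℂ) * (stepTranslation a : ℂ)) = w n) ∧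
      Tendsto (fun n : ℕ =>
          deriv ψ (Complex.I + (n : ℂ) * (stepTranslation a : ℂ)) / ((w n).im : ℂ))
        atTop (𝓝 1) ∧
      -- its boundary behaviour at infinity
      NTTendstoAtInfty ψ (Bornology.cobounded ℂ)) ∧
    Tendsto (fun n => deriv φ (w n)) atTop (𝓝 1) := by
  have h := hφ.isBackwardOrbit hw
  have ha0 : 0 ≤ a := ge_of_tendsto hstep (Eventually.of_forall fun n => norm_nonneg _)
  have hT := hw.tendsto_stepSinhSq ha0 ha hstep
  have hv := h.tendsto_stepVec hT hinf harg
  have hb : 0 < stepTranslation a := by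
    rw [stepTranslation_eq_sqrt ha0]
    exact Real.sqrt_pos.mpr (by linarith [h.limit_pos hT hinf])
  rw [← stepTranslation_eq_sqrt ha0] at hv
  refine ⟨?_, ?_, h.tendsto_deriv (h.tendsto_heightRatio_of_stepVec hv)⟩
  · refine ((Complex.continuous_re.tendsto _).comp hv).congr fun n => ?_
    rw [Function.comp_apply, stepVec, Complex.div_ofReal_re, Complex.sub_re]
  · obtain ⟨ψ, hψ⟩ := h.exists_tendsto_normIter hv hb.ne'
    have hψs : IsAnalyticSelfMap ψ := ⟨h.limit_differentiableOn hψ, h.limit_im_pos hψ⟩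
    exact ⟨ψ, hψ, hψs, fun z hz => h.limit_sub hv hψ hz, h.limit_add_nat_mul hv hψ,
      h.tendsto_deriv_limit hv hb.ne' hψ,
      hψs.nTTendstoAtInfty (h.tendsto_limit_line hv hb hψ hinf)⟩
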